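/- **Setting.** Let $f:\mathbb R^n\to\mathbb R$, $c:\mathbb R^n\to\mathbb R^m$ and consider $\min f(x)$ s.t. $c(x)=0$. Write $g=\nabla f$, $A(x)=\nabla c(x)^\top\in\mathbb R^{m\times n}$, $P(x)$ for the orthogonal projection onto $\mathcal N(A(x))$, $\mathcal L(x,\lambda)=f(x)+\lambda^\top c(x)$, $\varphi(x,\mu)=f(x)+\mu\|c(x)\|_1$; a subscript $k$ means evaluation at $x_k$; $\|\cdot\|$ is the Euclidean (operator) norm. **Algorithm (SCP).** Constants: $\sigma_{\min}>0$, $\mu_{-1}>0$, $0<\eta_1<\eta_2<1$, $\nu>1$, $\tau\in(0,1)$, $\theta\in(0,1]$, $\zeta\in(0,\theta)$, $\gamma_2>\gamma_1>1$, $\gamma_3\in(0,1]$, $\delta\in(0,1/6)$, $r_v\in[0,1-\tau)$, $r_\lambda,r_w\ge 0$; start from any $x_0$ and $\sigma_0\ge\sigma_{\min}$. At every iteration $k\ge0$: 1. *Normal step*: $v_k=\beta_kv_k^c$, where $v_k^c\in\mathcal R(A_k^\top)$ and $\|A_kv_k^c+c_k\|_1\le r_v\min\{\|c_k\|_1,\|v_k^c\|^3\}$.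 If $c_k=0$, then $v_k^c=0$ and $\beta_k=1$; otherwise $\beta_k\in\big[\min\{1,\tfrac{\theta}{\|v_k^c\|\sqrt{\sigma_k}}\},\min\{1,\tfrac{1}{\|v_k^c\|\sqrt{\sigma_k}}\}\big]$. 2. *Dual variables*: $\lambda_k\in\mathbb R^m$ with $\|A_k(g_k+A_k^\top\lambda_k)\|\le r_\lambda\|v_k\|$. Put $H_k=\nabla^2f_k+\sum_i\lambda_k^i\nabla^2c^i_k$. 3. *Tangential step*: with $\widetilde g_k=P_k^\top(g_k+H_kv_k)$, $\widetilde H_k=P_k^\top H_kP_k$, $m_k^U(u)=f_k+\widetilde g_k^\top u+\frac12u^\top\widetilde H_ku+\frac{\sigma_k}{3}\|P_ku\|^3$ and $\Delta m_k^U(u)=m_k^U(0)-m_k^U(u)$, the step $u_k\in\mathcal R(P_k)$ satisfies (OR1) $\Delta m_k^U(u_k)\ge\Delta m_k^U(-\alpha_k^*\widetilde g_k)$, where $\alpha_k^*$ minimizes $m_k^U(-\alpha\widetilde g_k)$ over $\alpha\ge0$; (OR2) $\|\nabla m_k^U(u_k)\|\le\delta\sigma_k\|u_k\|^2$; (OR3)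 $\lambda_{\min}(\widetilde H_k)\ge-\sigma_k\|u_k\|$. Put $d_k=v_k+u_k$. 4. *Merit parameter*: $\mu_k^c=0$ if $c_k=0$, otherwise $\mu_k^c=\dfrac{g_k^\top v_k+\frac12v_k^\top H_kv_k+\frac{\sigma_k}{3}(\|d_k\|^3-\|u_k\|^3)}{(1-r_v-\tau)\beta_k\|c_k\|_1}$; $\mu_k=\nu\mu_k^c$ if $\mu_{k-1}<\mu_k^c$, and $\mu_k=\mu_{k-1}$ otherwise. 5. *Acceptance*: let $q_k(d)=f_k+g_k^\top d+\frac12d^\top H_kd+\frac{\sigma_k}{3}\|d\|^3+\mu_k\|c_k+A_kd\|_1$, $\Delta q_k=q_k(0)-q_k(d_k)$ and $\rho_k=\frac{\varphi(x_k,\mu_k)-\varphi(x_k+d_k,\mu_k)}{\Delta q_k}$. If $\rho_k\ge\eta_1$, then $x_{k+1}=x_k+d_k$. If $\rho_k<\eta_1$ and $\|v_k^c\|\le\zeta/\sqrt{\sigma_k}$, compute a correction $w_k\in\mathcal R(A_k^\top)$ with $\|A_kw_k+c(x_k+d_k)\|\le r_w\|d_k\|^3$, and set $x_{k+1}=x_k+d_k+w_k$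 if $\rho_k^{corr}=\frac{\varphi(x_k,\mu_k)-\varphi(x_k+d_k+w_k,\mu_k)}{\Delta q_k}\ge\eta_1$. In all other cases $x_{k+1}=x_k$. 6. *Regularization*: let $r=\rho_k^{corr}$ if a correction was computed and $r=\rho_k$ otherwise. Then $\sigma_{k+1}\in[\max\{\sigma_{\min},\gamma_3\sigma_k\},\sigma_k]$ if $r>\eta_2$; $\sigma_{k+1}=\sigma_k$ if $\eta_1\le r\le\eta_2$; $\sigma_{k+1}\in[\gamma_1\sigma_k,\gamma_2\sigma_k]$ if $r<\eta_1$. Iteration $k$ is *successful* if $r\ge\eta_1$. The algorithm is run without a stopping test (with the convention $0/0=0$ for the ratios), so that it produces an infinite sequence. **Assumptions.** $\mathcal X$ is an open convex set containing all iterates $x_k$, and * (F1) $f,c$ are $C^2$ over $\mathcal X$, and $f,\nabla f,c_i,\nabla c_i$ $(1\le i\le m)$ are bounded and Lipschitz continuous over $\mathcal X$; * (F2) there is $\gamma_A>0$ with $\sigma_{\min}(A(x))\ge\gamma_A$, i.e. $\|A(x)^\top y\|\ge\gamma_A\|y\|$ for all $y\in\mathbb R^m$, for every $x\in\mathcal X$;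 * (F3) $\|H_k\|\le\kappa_H$ for all $k$, for some $\kappa_H>0$; * (F4) $f(x_k)\ge f_{low}$ for all successful $k$, for some $f_{low}\in\mathbb R$; * (F5) $\nabla^2f$ and $\nabla^2c_i$ $(1\le i\le m)$ are bounded and Lipschitz continuous over $\mathcal X$. **Theorem.** Let $\{x_k\}$ be generated by the algorithm and suppose that (F1)–(F5) hold. Suppose that $x_k\to x^*$, that $f$ and $c$ are $C^2$ in a neighbourhood of $x^*$, and that for some $\lambda^*\in\mathbb R^m$ the second-order sufficient conditions hold: $\nabla_x\mathcal L(x^*,\lambda^*)=0$, $c(x^*)=0$, and $Z_*^\top\nabla^2_{xx}\mathcal L(x^*,\lambda^*)Z_*$ is positive definite, where the columns of $Z_*$ form an orthonormal basis of $\mathcal N(A(x^*))$. Then $\{x_k\}$ converges to $x^*$ Q-quadratically: there is $M>0$ such that $\|x_{k+1}-x^*\|\le M\|x_k-x^*\|^2$ for all sufficiently large $k$. -/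

import Mathlib

noncomputable section

namespace SCP

/-! ### The problem `min f(x)` subject to `c(x) = 0` -/

/-- Euclidean space of dimension `n`. -/
abbrev E (n : ℕ) : Type := EuclideanSpace ℝ (Fin n)

/-- The `ℓ¹` norm of a vector. -/
def l1 {m : ℕ} (y : E m) : ℝ := ∑ i, |y i|

/-- The `i`-th constraint function. -/
def comp {n m : ℕ} (c : E n → E m) (i : Fin m) : E n → ℝ := fun x => c x i

/-- The Hessian of a scalar function, as a linear operator. -/
def hess {n : ℕ} (F : E n → ℝ) (x : E n) : E n →L[ℝ] E n := fderiv ℝ (gradient F) x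

/-- The Jacobian `A(x) = ∇c(x)ᵀ` of the constraints. -/
def jac {n m : ℕ} (c : E n → E m) (x : E n) : E n →L[ℝ] E m := fderiv ℝ c x

/-- The transpose `A(x)ᵀ` of the Jacobian. -/
def jacT {n m : ℕ} (c : E n → E m) (x : E n) : E m →L[ℝ] E n :=
  ContinuousLinearMap.adjoint (jac c x)

/-- The null space `N(A(x))` of the Jacobian. -/
def nullA {n m : ℕ} (c : E n → E m) (x : E n) : Submodule ℝ (E n) :=
  LinearMap.ker (jac c x).toLinearMap

/-- The orthogonal projection `P(x)` onto `N(A(x))`. It is symmetric, `P(x)ᵀ = P(x)`. -/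
def proj {n m : ℕ} (c : E n → E m) (x : E n) : E n →L[ℝ] E n := (nullA c x).starProjection

/-- The Lagrangian `L(x, l) = f(x) + lᵀ c(x)`. -/
def lagr {n m : ℕ} (f : E n → ℝ) (c : E n → E m) (x : E n) (l : E m) : ℝ :=
  f x + inner ℝ l (c x)

/-- The matrix `∇²f(x) + ∑ᵢ lᵢ ∇²cᵢ(x)`. -/
def hessL {n m : ℕ} (f : E n → ℝ) (c : E n → E m) (x : E n) (l : E m) : E n →L[ℝ] E n :=
  hess f x + ∑ i, l i • hess (comp c i) x

/-- The smallest eigenvalue of a symmetric operator. -/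
def lambdaMin {n : ℕ} (T : E n →L[ℝ] E n) : ℝ :=
  sInf {a : ℝ | Module.End.HasEigenvalue T.toLinearMap a}

/-- The `ℓ¹` merit function `φ(x, μ) = f(x) + μ ‖c(x)‖₁`. -/
def merit {n m : ℕ} (f : E n → ℝ) (c : E n → E m) (x : E n) (μ : ℝ) : ℝ :=
  f x + μ * l1 (c x)

/-! ### The sequential cubic programming algorithm -/

/-- The user-chosen constants of the algorithm; `muInit` is the initial merit parameter `μ₋₁`. -/
structure Params where
  sigmaMin : ℝ
  muInit : ℝ
  η₁ : ℝ
  η₂ : ℝ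
  ν : ℝ
  τ : ℝ
  θ : ℝ
  ζ : ℝ
  γ₁ : ℝ
  γ₂ : ℝ
  γ₃ : ℝ
  δ : ℝ
  rv : ℝ
  rlam : ℝ
  rw : ℝ

/-- The admissible ranges of the constants. -/
structure Params.Valid (p : Params) : Prop where
  sigmaMin_pos : 0 < p.sigmaMin
  muInit_pos : 0 < p.muInit
  η₁_pos : 0 < p.η₁
  η₁_lt : p.η₁ < p.η₂
  η₂_lt : p.η₂ < 1
  ν_gt : 1 < p.ν
  τ_mem : p.τ ∈ Set.Ioo (0 : ℝ) 1
  θ_mem : p.θ ∈ Set.Ioc (0 : ℝ) 1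
  ζ_mem : p.ζ ∈ Set.Ioo (0 : ℝ) p.θ
  γ₁_gt : 1 < p.γ₁
  γ₂_gt : p.γ₁ < p.γ₂
  γ₃_mem : p.γ₃ ∈ Set.Ioc (0 : ℝ) 1
  δ_mem : p.δ ∈ Set.Ioo (0 : ℝ) (1 / 6)
  rv_mem : p.rv ∈ Set.Ico (0 : ℝ) (1 - p.τ)
  rlam_nonneg : 0 ≤ p.rlam
  rw_nonneg : 0 ≤ p.rw

/-- The quantities that a run of the algorithm produces: iterates `x`, regularization
parameters `σ`, dual variables `lam`, unscaled normal steps `vc`, feasibility parameters `β`,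
tangential steps `u`, merit parameters `μ`, second-order corrections `w` (the value `w k` is
meaningful only if a correction is computed at iteration `k`). -/
structure History (n m : ℕ) where
  x : ℕ → E n
  σ : ℕ → ℝ
  lam : ℕ → E m
  vc : ℕ → E n
  β : ℕ → ℝ
  u : ℕ → E n
  μ : ℕ → ℝ
  w : ℕ → E n

namespace History

variable {n m : ℕ} (h : History n m) (f : E n → ℝ) (c : E n → E m) (p : Params) (k : ℕ)

/-- The normal step `v_k = β_k v_kᶜ`. -/
def v : E n := h.β k • h.vc k

/-- The trial step `d_k = v_k + u_k`. -/
def d : E n := h.v k + h.u k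

/-- The Hessian `H_k`. -/
def H : E n →L[ℝ] E n := hessL f c (h.x k) (h.lam k)

/-- The reduced gradient `g̃_k = P_kᵀ (g_k + H_k v_k)`. -/
def gTilde : E n := proj c (h.x k) (gradient f (h.x k) + h.H f c k (h.v k))

/-- The reduced Hessian `H̃_k = P_kᵀ H_k P_k`. -/
def HTilde : E n →L[ℝ] E n := proj c (h.x k) ∘L h.H f c k ∘L proj c (h.x k)

/-- The reduced cubic model `m_kᵁ`. -/
def mU (y : E n) : ℝ :=
  f (h.x k) + inner ℝ (h.gTilde f c k) y + 1 / 2 * inner ℝ y (h.HTilde f c k y)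
    + h.σ k / 3 * ‖proj c (h.x k) y‖ ^ 3

/-- The predicted reduction `m_kᵁ(0) - m_kᵁ(y)`. -/
def deltaM (y : E n) : ℝ := h.mU f c k 0 - h.mU f c k y

/-- The cubic model `q_k` of the merit function. -/
def q (y : E n) : ℝ :=
  f (h.x k) + inner ℝ (gradient f (h.x k)) y + 1 / 2 * inner ℝ y (h.H f c k y)
    + h.σ k / 3 * ‖y‖ ^ 3 + h.μ k * l1 (c (h.x k) + jac c (h.x k) y)

/-- The predicted reduction `Δq_k`. -/
def deltaQ : ℝ := h.q f c k 0 - h.q f c k (h.d k)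

/-- The ratio `ρ_k`. -/
def ρ : ℝ :=
  (merit f c (h.x k) (h.μ k) - merit f c (h.x k + h.d k) (h.μ k)) / h.deltaQ f c k

/-- The ratio `ρ_kᶜᵒʳʳ`. -/
def ρcorr : ℝ :=
  (merit f c (h.x k) (h.μ k) - merit f c (h.x k + h.d k + h.w k) (h.μ k)) / h.deltaQ f c k

/-- Membership in the set `K` of almost feasible iterations. -/
def inK : Prop := ‖h.vc k‖ ≤ p.ζ / √(h.σ k)

/-- A second-order correction is computed at iteration `k`. -/
def Corrected : Prop := h.ρ f c k < p.η₁ ∧ h.inK p k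

open Classical in
/-- The ratio that decides on iteration `k`: `ρ_kᶜᵒʳʳ` if a correction is computed,
`ρ_k` otherwise. -/
def ratio : ℝ := if h.Corrected f c p k then h.ρcorr f c k else h.ρ f c k

/-- Iteration `k` is successful (possibly very successful). -/
def Successful : Prop := p.η₁ ≤ h.ratio f c p k

/-- The merit parameter `μ_{k-1}`. -/
def muPrev : ℕ → ℝ
  | 0 => p.muInit
  | k + 1 => h.μ k

/-- The quantity `μ_kᶜ` in the update of the merit parameter. -/
def muC : ℝ :=
  if l1 (c (h.x k)) = 0 then 0
  else
    (inner ℝ (gradient f (h.x k)) (h.v k) + 1 / 2 * inner ℝ (h.v k) (h.H f c k (h.v k))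
        + h.σ k / 3 * (‖h.d k‖ ^ 3 - ‖h.u k‖ ^ 3))
      / ((1 - p.rv - p.τ) * h.β k * l1 (c (h.x k)))

/-- The requirements on the normal step: `v_kᶜ ∈ R(A_kᵀ)`, the inexact feasibility condition,
and the admissible interval of `β_k`. -/
structure NormalStep : Prop where
  mem_range : h.vc k ∈ Set.range (jacT c (h.x k))
  residual : l1 (jac c (h.x k) (h.vc k) + c (h.x k))
    ≤ p.rv * min (l1 (c (h.x k))) (‖h.vc k‖ ^ 3)
  feasible : c (h.x k) = 0 → h.vc k = 0 ∧ h.β k = 1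
  infeasible : c (h.x k) ≠ 0 →
    h.β k ∈ Set.Icc (min 1 (p.θ / (‖h.vc k‖ * √(h.σ k)))) (min 1 (1 / (‖h.vc k‖ * √(h.σ k))))

/-- The requirements on the tangential step: `u_k ∈ R(P_k)`, at least the Cauchy decrease,
a small model gradient, and a bound on the negative curvature. -/
structure TangentialStep : Prop where
  mem_range : h.u k ∈ Set.range (proj c (h.x k))
  cauchy : ∃ a : ℝ, 0 ≤ a ∧
    (∀ t : ℝ, 0 ≤ t → h.mU f c k (-(a • h.gTilde f c k)) ≤ h.mU f c k (-(t • h.gTilde f c k))) ∧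
    h.deltaM f c k (-(a • h.gTilde f c k)) ≤ h.deltaM f c k (h.u k)
  gradient_le : ‖gradient (h.mU f c k) (h.u k)‖ ≤ p.δ * h.σ k * ‖h.u k‖ ^ 2
  curvature : -(h.σ k * ‖h.u k‖) ≤ lambdaMin (h.HTilde f c k)

open Classical in
/-- `h` is an infinite run of the algorithm with constants `p` for the problem `(f, c)`.
There is no stopping test; a run that reaches a point where it could stop stays there. -/
structure IsRun : Prop where
  sigma_init : p.sigmaMin ≤ h.σ 0
  normal : ∀ k, h.NormalStep c p k
  dual : ∀ k, ‖jac c (h.x k) (gradient f (h.x k) + jacT c (h.x k) (h.lam k))‖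
    ≤ p.rlam * ‖h.v k‖
  tangential : ∀ k, h.TangentialStep f c p k
  merit_update : ∀ k, h.μ k =
    if h.muPrev p k < h.muC f c p k then p.ν * h.muC f c p k else h.muPrev p k
  correction : ∀ k, h.Corrected f c p k →
    h.w k ∈ Set.range (jacT c (h.x k)) ∧
    ‖jac c (h.x k) (h.w k) + c (h.x k + h.d k)‖ ≤ p.rw * ‖h.d k‖ ^ 3
  x_update : ∀ k, h.x (k + 1) =
    if p.η₁ ≤ h.ρ f c k then h.x k + h.d k
    else if h.inK p k ∧ p.η₁ ≤ h.ρcorr f c k then h.x k + h.d k + h.w k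
    else h.x k
  sigma_very_successful : ∀ k, p.η₂ < h.ratio f c p k →
    h.σ (k + 1) ∈ Set.Icc (max p.sigmaMin (p.γ₃ * h.σ k)) (h.σ k)
  sigma_successful : ∀ k, p.η₁ ≤ h.ratio f c p k → h.ratio f c p k ≤ p.η₂ →
    h.σ (k + 1) = h.σ k
  sigma_unsuccessful : ∀ k, h.ratio f c p k < p.η₁ →
    h.σ (k + 1) ∈ Set.Icc (p.γ₁ * h.σ k) (p.γ₂ * h.σ k)

end History

/-! ### Assumptions -/

/-- `F` is bounded on `X`. -/
def BddOn {n : ℕ} {G : Type*} [NormedAddCommGroup G] (F : E n → G) (X : Set (E n)) : Prop :=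
  ∃ κ : ℝ, ∀ x ∈ X, ‖F x‖ ≤ κ

/-- `F` is Lipschitz continuous on `X`. -/
def LipOn {n : ℕ} {G : Type*} [NormedAddCommGroup G] (F : E n → G) (X : Set (E n)) : Prop :=
  ∃ L : NNReal, LipschitzOnWith L F X

/-- (F1): `f` and `c` are `C²` over `X`; `f`, `∇f`, all `cᵢ` and all `∇cᵢ` are bounded and
Lipschitz continuous over `X`. -/
structure F1 {n m : ℕ} (f : E n → ℝ) (c : E n → E m) (X : Set (E n)) : Prop where
  f_smooth : ContDiffOn ℝ 2 f X
  c_smooth : ContDiffOn ℝ 2 c X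
  f_bdd : BddOn f X
  g_bdd : BddOn (gradient f) X
  c_bdd : ∀ i, BddOn (comp c i) X
  gc_bdd : ∀ i, BddOn (gradient (comp c i)) X
  f_lip : LipOn f X
  g_lip : LipOn (gradient f) X
  c_lip : ∀ i, LipOn (comp c i) X
  gc_lip : ∀ i, LipOn (gradient (comp c i)) X

/-- (F2): the least singular value of the `m × n` Jacobian, that is, the minimum of
`‖A(x)ᵀ y‖` over unit vectors `y`, is at least some `γ_A > 0` throughout `X`. -/
def F2 {n m : ℕ} (c : E n → E m) (X : Set (E n)) : Prop :=
  ∃ γA : ℝ, 0 < γA ∧ ∀ x ∈ X, ∀ y : E m, γA * ‖y‖ ≤ ‖jacT c x y‖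

/-- (F3): the Hessians `H_k` are uniformly bounded. -/
def F3 {n m : ℕ} (f : E n → ℝ) (c : E n → E m) (h : History n m) : Prop :=
  ∃ κH : ℝ, 0 < κH ∧ ∀ k, ‖h.H f c k‖ ≤ κH

/-- (F4): `f` is bounded below on the successful iterates. -/
def F4 {n m : ℕ} (f : E n → ℝ) (c : E n → E m) (p : Params) (h : History n m) : Prop :=
  ∃ flow : ℝ, ∀ k, h.Successful f c p k → flow ≤ f (h.x k)

/-- (F5): `∇²f` and all `∇²cᵢ` are bounded and Lipschitz continuous over `X`. -/
structure F5 {n m : ℕ} (f : E n → ℝ) (c : E n → E m) (X : Set (E n)) : Prop where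
  hf_bdd : BddOn (hess f) X
  hc_bdd : ∀ i, BddOn (hess (comp c i)) X
  hf_lip : LipOn (hess f) X
  hc_lip : ∀ i, LipOn (hess (comp c i)) X

/-- The second-order sufficient conditions at `(xs, ls)`: stationarity of the Lagrangian,
feasibility, and positive definiteness of the reduced Hessian `Zᵀ ∇²ₓₓL(xs, ls) Z`, the columns
of `Z` being an orthonormal basis of `N(A(xs))`. -/
structure SOSC {n m : ℕ} (f : E n → ℝ) (c : E n → E m) (xs : E n) (ls : E m) : Prop where
  stationary : gradient (fun x => lagr f c x ls) xs = 0
  feasible : c xs = 0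
  reduced_posDef :
    ∃ Z : OrthonormalBasis (Fin (Module.finrank ℝ (nullA c xs))) ℝ (nullA c xs),
      (Matrix.of fun i j =>
        inner ℝ (Z i : E n) (hess (fun x => lagr f c x ls) xs (Z j : E n))).PosDef

/-- `x_k → xs` Q-quadratically. -/
def QQuadratic {n : ℕ} (x : ℕ → E n) (xs : E n) : Prop :=
  Filter.Tendsto x Filter.atTop (nhds xs) ∧
    ∃ M : ℝ, 0 < M ∧ ∀ᶠ k in Filter.atTop, ‖x (k + 1) - xs‖ ≤ M * ‖x k - xs‖ ^ 2

end SCP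

end

/-!
Near `x*` the algorithm behaves like an inexact Newton method on the optimality system of the
equality constrained problem, and its safeguards become inactive.

*Coercivity.* The multiplier estimates satisfy `λ_k - λ* = O(‖x_k - x*‖)`, so `H_k` converges to
the Hessian of the Lagrangian, and the second order sufficient conditions make `H_k` uniformly
positive definite on the null space of `A_k` (`exists_pos_eventually_coercive`). Together with the
approximate stationarity of `u_k` this bounds `u_k` by the reduced gradient, gives
`σ_k ‖u_k‖² → 0`, and makes the tangential model decrease by a multiple of `‖u_k‖²`, for every size
of `σ_k` (`exists_tangential_bounds`). The merit parameters are then bounded (`mu_isBigO_one`), and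
the predicted reduction is at least a multiple of `‖u_k‖² + ‖v_k‖` (`exists_deltaQ_coercive`).

*Acceptance.* If `‖v_kᶜ‖ > ζ / √σ_k`, then `‖u_k‖ = O(‖v_k‖)`, the predicted reduction is of first
order in the step and the model error of second order, so the trial step is accepted
(`eventually_rho_ge`). Otherwise `β_k = 1`, and the correction is `O(‖d_k‖²)` and leaves an
infeasibility `O(‖d_k‖³)`; exchanging `f` for the Lagrangian then shows that the actual
reduction falls short of the predicted one by at most `o(‖d_k‖²)`, whereas
the predicted reduction is at least a multiple of `‖d_k‖²`
(`merit_corrected_isLittleO`, `eventually_rhocorr_ge`). Trial points may lie outside the set where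
the Hessians are Lipschitz continuous; here only `C²` smoothness at `x*` is used.

*Rate.* Expanding the optimality conditions at `x_k` and testing the projected equation with the
null space component of the error bounds `‖x_k + d_k - x*‖` by a multiple of the sum of
`‖x_k - x*‖²`, `σ_k ‖u_k‖²` and the linearized infeasibility (`newton_isBigO`). If a sufficiently
late iterate equals `x*`, the sequence stays there. Otherwise every late iteration is successful, so
`σ_k` is bounded, full normal steps are taken, and all three terms are `O(‖x_k - x*‖²)`
(`step_isBigO_of_successful`).
-/

namespace SCP

open Filter Topology Asymptotics Metric
open scoped InnerProductSpace

/-! ### The `ℓ¹` norm -/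

theorem l1_nonneg {m : ℕ} (y : E m) : 0 ≤ l1 y := Finset.sum_nonneg fun _ _ => abs_nonneg _

theorem l1_zero {m : ℕ} : l1 (0 : E m) = 0 := by simp [l1]

theorem l1_add_le {m : ℕ} (y z : E m) : l1 (y + z) ≤ l1 y + l1 z := by
  unfold l1
  rw [← Finset.sum_add_distrib]
  exact Finset.sum_le_sum fun i _ => abs_add_le _ _

theorem l1_smul {m : ℕ} (a : ℝ) (y : E m) : l1 (a • y) = |a| * l1 y := by
  simp [l1, Finset.mul_sum, abs_mul]

theorem norm_le_l1 {m : ℕ} (y : E m) : ‖y‖ ≤ l1 y := by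
  rw [EuclideanSpace.norm_eq]
  refine Real.sqrt_le_iff.2 ⟨l1_nonneg y, ?_⟩
  exact Finset.sum_sq_le_sq_sum_of_nonneg fun i _ => norm_nonneg (y i)

theorem l1_le_mul_norm {m : ℕ} (y : E m) : l1 y ≤ m * ‖y‖ := by
  unfold l1
  calc ∑ i, |y i| ≤ ∑ _i : Fin m, ‖y‖ := Finset.sum_le_sum fun i _ => PiLp.norm_apply_le y i
    _ = m * ‖y‖ := by simp

theorem l1_eq_zero {m : ℕ} {y : E m} : l1 y = 0 ↔ y = 0 :=
  ⟨fun h => norm_le_zero_iff.1 ((norm_le_l1 y).trans h.le), fun h => h ▸ l1_zero⟩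

/-! ### Gradients and Hessians -/

/-- The inverse of the Riesz isomorphism, as a linear map. -/
noncomputable def rieszInv (n : ℕ) : (E n →L[ℝ] ℝ) →L[ℝ] E n :=
  LinearMap.mkContinuous
    { toFun := fun φ => (InnerProductSpace.toDual ℝ (E n)).symm φ
      map_add' := fun _ _ => map_add _ _ _
      map_smul' := fun a φ => by simp } 1 (fun φ => by simp)

theorem inner_rieszInv {n : ℕ} (φ : E n →L[ℝ] ℝ) (v : E n) : ⟪rieszInv n φ, v⟫_ℝ = φ v :=
  InnerProductSpace.toDual_symm_apply

theorem gradient_eq_rieszInv {n : ℕ} (F : E n → ℝ) :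
    gradient F = fun x => rieszInv n (fderiv ℝ F x) := rfl

theorem contDiffAt_gradient {n : ℕ} {F : E n → ℝ} {x : E n} (hF : ContDiffAt ℝ 2 F x) :
    ContDiffAt ℝ 1 (gradient F) x := by
  rw [gradient_eq_rieszInv]
  exact (rieszInv n).contDiff.contDiffAt.comp x (hF.fderiv_right (m := 1) (by norm_num))

theorem differentiableAt_gradient {n : ℕ} {F : E n → ℝ} {x : E n} (hF : ContDiffAt ℝ 2 F x) :
    DifferentiableAt ℝ (gradient F) x :=
  (contDiffAt_gradient hF).differentiableAt (by norm_num)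

theorem continuousAt_hess {n : ℕ} {F : E n → ℝ} {x : E n} (hF : ContDiffAt ℝ 2 F x) :
    ContinuousAt (hess F) x :=
  ((contDiffAt_gradient hF).fderiv_right (m := 0) (by norm_num)).continuousAt

theorem inner_hess {n : ℕ} {F : E n → ℝ} {x : E n} (hF : ContDiffAt ℝ 2 F x) (v w : E n) :
    ⟪hess F x v, w⟫_ℝ = fderiv ℝ (fderiv ℝ F) x v w := by
  have h1 : HasFDerivAt (gradient F) ((rieszInv n).comp (fderiv ℝ (fderiv ℝ F) x)) x := by
    rw [gradient_eq_rieszInv]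
    exact (rieszInv n).hasFDerivAt.comp x
      ((hF.fderiv_right (m := 1) (by norm_num)).differentiableAt (by norm_num)).hasFDerivAt
  rw [hess, h1.fderiv]
  exact inner_rieszInv _ _

theorem hess_symm {n : ℕ} {F : E n → ℝ} {x : E n} (hF : ContDiffAt ℝ 2 F x) (v w : E n) :
    ⟪hess F x v, w⟫_ℝ = ⟪v, hess F x w⟫_ℝ := by
  rw [inner_hess hF, real_inner_comm, inner_hess hF]
  exact (hF.isSymmSndFDerivAt (by simp)) v w

/-- The second order Taylor expansion of a `C²` function, uniformly in the base point. -/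
theorem taylor_two_isLittleO {n : ℕ} {F : E n → ℝ} {xs : E n} (hF : ContDiffAt ℝ 2 F xs) :
    (fun z : E n × E n => F (z.1 + z.2) - F z.1 - ⟪gradient F z.1, z.2⟫_ℝ
      - 1 / 2 * ⟪z.2, hess F z.1 z.2⟫_ℝ) =o[𝓝 (xs, 0)] fun z => ‖z.2‖ ^ 2 := by
  rw [isLittleO_iff]
  intro ε hε
  have h1 : ∀ᶠ y in 𝓝 xs, ContDiffAt ℝ 2 F y ∧ ‖hess F y - hess F xs‖ < ε / 2 := by
    refine (hF.eventually (by simp)).and ?_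
    have := (continuousAt_hess hF).tendsto.sub_const (hess F xs)
    rw [sub_self] at this
    simpa using this.norm.eventually_lt_const (by simpa using half_pos hε)
  obtain ⟨r, hr, hball⟩ := Metric.eventually_nhds_iff_ball.1 h1
  have h2 : ∀ᶠ z : E n × E n in 𝓝 (xs, 0), z.1 ∈ ball xs (r / 2) ∧ z.2 ∈ ball 0 (r / 2) := by
    rw [nhds_prod_eq]
    exact prod_mem_prod (ball_mem_nhds _ (half_pos hr)) (ball_mem_nhds _ (half_pos hr))
  filter_upwards [h2] with ⟨x, s⟩ ⟨hx, hs⟩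
  simp only [mem_ball, dist_eq_norm, sub_zero] at hx hs
  have hseg : ∀ y ∈ segment ℝ x (x + s), y ∈ ball xs r ∧ ‖y - x‖ ≤ ‖s‖ := by
    intro y hy
    rw [segment_eq_image'] at hy
    obtain ⟨t, ht, rfl⟩ := hy
    have h3 : ‖x + t • (x + s - x) - x‖ ≤ ‖s‖ := by
      simpa [norm_smul, abs_of_nonneg ht.1] using mul_le_of_le_one_left (norm_nonneg s) ht.2
    refine ⟨?_, h3⟩
    rw [mem_ball, dist_eq_norm]
    calc _ = ‖(x + t • (x + s - x) - x) + (x - xs)‖ := by congr 1; module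
      _ ≤ _ := norm_add_le _ _
      _ < r := by linarith
  have hxx := hball x (hseg x (left_mem_segment ℝ _ _)).1
  have hgrad : ∀ y ∈ segment ℝ x (x + s),
      ‖gradient F y - gradient F x - hess F x (y - x)‖ ≤ ε * ‖y - x‖ := by
    intro y hy
    refine (convex_segment x (x + s)).norm_image_sub_le_of_norm_hasFDerivWithin_le'
      (f' := hess F) (fun y hy => ?_) (fun y hy => ?_) (left_mem_segment ℝ _ _) hy
    · exact (differentiableAt_gradient (hball y (hseg y hy).1).1).hasFDerivAt.hasFDerivWithinAt
    · have h4 := (hball y (hseg y hy).1).2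
      calc ‖hess F y - hess F x‖ = ‖(hess F y - hess F xs) - (hess F x - hess F xs)‖ := by
            congr 1; abel
        _ ≤ _ := norm_sub_le _ _
        _ ≤ ε := by linarith [hxx.2]
  -- the mean value inequality is applied to `F` minus its quadratic model at `x`
  let H := hess F x
  let D : E n → (E n →L[ℝ] ℝ) := fun y => fderiv ℝ F y - innerSL ℝ (gradient F x)
    - innerSL ℝ (H (y - x))
  have hG : ∀ y ∈ segment ℝ x (x + s), HasFDerivWithinAt
      (fun y => F y - ⟪gradient F x, y - x⟫_ℝ - 1 / 2 * ⟪y - x, H (y - x)⟫_ℝ) (D y)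
      (segment ℝ x (x + s)) y := by
    intro y hy
    have hd1 : HasFDerivAt F (fderiv ℝ F y) y :=
      ((hball y (hseg y hy).1).1.differentiableAt (by norm_num)).hasFDerivAt
    have hd0 : HasFDerivAt (fun y : E n => y - x) (ContinuousLinearMap.id ℝ (E n)) y :=
      (hasFDerivAt_id y).sub_const x
    have hd2 := (innerSL ℝ (gradient F x)).hasFDerivAt.comp y hd0
    have hd3 := ((hd0.inner ℝ (H.hasFDerivAt.comp y hd0)).const_mul (1 / 2 : ℝ))
    refine (((hd1.sub hd2).sub hd3).congr_fderiv ?_).hasFDerivWithinAt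
    ext v
    have := hess_symm hxx.1 (y - x) v
    simp only [D, H, sub_apply, smul_apply,
      ContinuousLinearMap.comp_apply, ContinuousLinearMap.id_apply, innerSL_apply_apply,
      fderivInnerCLM_apply, ContinuousLinearMap.prod_apply, smul_eq_mul, Function.comp_apply]
    rw [← this, real_inner_comm _ v]
    ring
  have hD : ∀ y ∈ segment ℝ x (x + s), ‖D y‖ ≤ ε * ‖s‖ := by
    intro y hy
    have h5 : D y = innerSL ℝ (gradient F y - gradient F x - H (y - x)) := by
      ext v
      simp [D, inner_gradient_left]
    rw [h5, innerSL_apply_norm]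
    exact (hgrad y hy).trans (mul_le_mul_of_nonneg_left (hseg y hy).2 hε.le)
  have := (convex_segment x (x + s)).norm_image_sub_le_of_norm_hasFDerivWithin_le hG hD
    (left_mem_segment ℝ _ _) (right_mem_segment ℝ _ _)
  simp only [add_sub_cancel_left, sub_self, inner_zero_right, inner_zero_left, mul_zero,
    sub_zero] at this
  rw [norm_pow, norm_norm]
  calc _ = ‖F (x + s) - ⟪gradient F x, s⟫_ℝ - 1 / 2 * ⟪s, H s⟫_ℝ - F x‖ := by
        congr 1; ring
    _ ≤ ε * ‖s‖ * ‖s‖ := this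
    _ = ε * ‖s‖ ^ 2 := by ring

/-- The first order Taylor expansion with a shifted derivative, on a convex set where the
derivative is Lipschitz continuous. -/
theorem norm_taylor_one_le {V W : Type*} [NormedAddCommGroup V] [NormedSpace ℝ V]
    [NormedAddCommGroup W] [NormedSpace ℝ W] {F : V → W} {S : Set V} (hS : Convex ℝ S)
    (hF : ∀ y ∈ S, DifferentiableAt ℝ F y) {L : NNReal} (hL : LipschitzOnWith L (fderiv ℝ F) S)
    {x y z : V} (hx : x ∈ S) (hy : y ∈ S) (hz : z ∈ S) :
    ‖F z - F y - fderiv ℝ F x (z - y)‖ ≤ L * (‖y - x‖ + ‖z - y‖) * ‖z - y‖ := by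
  have hsub : segment ℝ y z ⊆ S := hS.segment_subset hy hz
  refine (convex_segment y z).norm_image_sub_le_of_norm_hasFDerivWithin_le'
    (f' := fderiv ℝ F) (fun t ht => (hF t (hsub ht)).hasFDerivAt.hasFDerivWithinAt)
    (fun t ht => ?_) (left_mem_segment ℝ _ _) (right_mem_segment ℝ _ _)
  refine (hL.norm_sub_le (hsub ht) hx).trans (mul_le_mul_of_nonneg_left ?_ L.2)
  rw [segment_eq_image'] at ht
  obtain ⟨a, ha, rfl⟩ := ht
  calc ‖y + a • (z - y) - x‖ = ‖(y - x) + a • (z - y)‖ := by congr 1; abel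
    _ ≤ ‖y - x‖ + ‖a • (z - y)‖ := norm_add_le _ _
    _ ≤ _ := by
      rw [norm_smul, Real.norm_eq_abs, abs_of_nonneg ha.1]
      gcongr
      exact mul_le_of_le_one_left (norm_nonneg _) ha.2

/-- A `C²` function satisfies the bound of `norm_taylor_one_le` near each point. -/
theorem exists_norm_taylor_one_le {V W : Type*} [NormedAddCommGroup V] [NormedSpace ℝ V]
    [NormedAddCommGroup W] [NormedSpace ℝ W] {F : V → W} {xs : V} (hF : ContDiffAt ℝ 2 F xs) :
    ∃ L : ℝ, 0 ≤ L ∧ ∃ r > 0, ∀ x ∈ ball xs r, ∀ y ∈ ball xs r, ∀ z ∈ ball xs r,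
      ‖F z - F y - fderiv ℝ F x (z - y)‖ ≤ L * (‖y - x‖ + ‖z - y‖) * ‖z - y‖ := by
  obtain ⟨L, t, ht, hL⟩ :=
    (hF.fderiv_right (m := 1) (by norm_num)).exists_lipschitzOnWith
  have h1 : ∀ᶠ y in 𝓝 xs, DifferentiableAt ℝ F y ∧ y ∈ t :=
    ((hF.eventually (by simp)).mono fun y hy => hy.differentiableAt (by norm_num)).and ht
  obtain ⟨r, hr, hball⟩ := Metric.eventually_nhds_iff_ball.1 h1
  exact ⟨L, L.2, r, hr, fun x hx y hy z hz => norm_taylor_one_le (convex_ball xs r)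
    (fun y hy => (hball y hy).1) (hL.mono fun y hy => (hball y hy).2) hx hy hz⟩

/-! ### Bounds for products and quotients -/

theorem isBigO_clm_apply {α V W : Type*} [NormedAddCommGroup V] [NormedSpace ℝ V]
    [NormedAddCommGroup W] [NormedSpace ℝ W] {l : Filter α} {T : α → V →L[ℝ] W}
    (hT : T =O[l] fun _ => (1 : ℝ)) (y : α → V) : (fun k => T k (y k)) =O[l] y := by
  have h1 := hT.norm_left.mul (isBigO_refl (fun k => ‖y k‖) l)
  simp only [one_mul] at h1
  exact (IsBigO.of_norm_le fun k => (T k).le_opNorm (y k)).trans h1.of_norm_right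

theorem isBigO_inner {α V : Type*} [NormedAddCommGroup V] [InnerProductSpace ℝ V] {l : Filter α}
    {y z : α → V} {a b : α → ℝ} (hy : y =O[l] a) (hz : z =O[l] b) :
    (fun k => ⟪y k, z k⟫_ℝ) =O[l] fun k => a k * b k :=
  (IsBigO.of_norm_le (g := fun k => ‖y k‖ * ‖z k‖) fun _ => norm_inner_le_norm _ _).trans
    (hy.norm_left.mul hz.norm_left)

/-- A step is accepted as soon as the model error is a sufficiently small fraction of the predicted
reduction `q`; here `a` is the actual reduction. -/
theorem le_div_of_error_le {a q η : ℝ} (hq : 0 < q) (he : q - a ≤ (1 - η) * q) : η ≤ a / q := by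
  rw [le_div_iff₀ hq]
  linarith

section

variable {n m : ℕ} {f : E n → ℝ} {c : E n → E m} {x : E n}

/-! ### The Lagrangian -/

theorem lagr_eq_sum (f : E n → ℝ) (c : E n → E m) (x : E n) (l : E m) :
    lagr f c x l = f x + ∑ i, l i * comp c i x := by
  simp [lagr, comp, PiLp.inner_apply, mul_comm]

theorem contDiffAt_comp (hc : ContDiffAt ℝ 2 c x) (i : Fin m) : ContDiffAt ℝ 2 (comp c i) x :=
  (EuclideanSpace.proj (𝕜 := ℝ) i).contDiff.contDiffAt.comp x hc

theorem jacT_eq_sum (hc : DifferentiableAt ℝ c x) (l : E m) :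
    jacT c x l = ∑ i, l i • gradient (comp c i) x := by
  refine ext_inner_right ℝ fun v => ?_
  rw [jacT, ContinuousLinearMap.adjoint_inner_left, sum_inner, PiLp.inner_apply]
  refine Finset.sum_congr rfl fun i _ => ?_
  have h1 : HasFDerivAt (comp c i) ((EuclideanSpace.proj (𝕜 := ℝ) i).comp (fderiv ℝ c x)) x :=
    (EuclideanSpace.proj (𝕜 := ℝ) i).hasFDerivAt.comp x hc.hasFDerivAt
  rw [inner_smul_left, inner_gradient_left, h1.fderiv]
  simp [jac, mul_comm]

theorem gradient_lagr (hf : DifferentiableAt ℝ f x) (hc : DifferentiableAt ℝ c x) (l : E m) :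
    gradient (fun y => lagr f c y l) x = gradient f x + jacT c x l := by
  refine HasGradientAt.gradient ?_
  rw [hasGradientAt_iff_hasFDerivAt]
  refine (hf.hasFDerivAt.add ((innerSL ℝ l).hasFDerivAt.comp x hc.hasFDerivAt)).congr_fderiv ?_
  ext v
  simp [jacT, ContinuousLinearMap.adjoint_inner_left, jac]

theorem gradient_lagr_eq_sum (hf : DifferentiableAt ℝ f x) (hc : DifferentiableAt ℝ c x)
    (l : E m) : gradient (fun y => lagr f c y l) x
      = gradient f x + ∑ i, l i • gradient (comp c i) x := by
  rw [gradient_lagr hf hc, jacT_eq_sum hc]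

theorem contDiffAt_lagr (hf : ContDiffAt ℝ 2 f x) (hc : ContDiffAt ℝ 2 c x) (l : E m) :
    ContDiffAt ℝ 2 (fun y => lagr f c y l) x :=
  hf.add ((innerSL ℝ l).contDiff.contDiffAt.comp x hc)

theorem hess_lagr (hf : ContDiffAt ℝ 2 f x) (hc : ContDiffAt ℝ 2 c x) (l : E m) :
    hess (fun y => lagr f c y l) x = hessL f c x l := by
  have h1 : gradient (fun y => lagr f c y l) =ᶠ[𝓝 x]
      fun y => gradient f y + ∑ i, l i • gradient (comp c i) y := by
    filter_upwards [hf.eventually (by simp), hc.eventually (by simp)] with y hy1 hy2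
    exact gradient_lagr_eq_sum (hy1.differentiableAt (by norm_num))
      (hy2.differentiableAt (by norm_num)) l
  rw [hess, h1.fderiv_eq]
  refine HasFDerivAt.fderiv ?_
  exact (differentiableAt_gradient hf).hasFDerivAt.add (HasFDerivAt.fun_sum fun i _ =>
    (differentiableAt_gradient (contDiffAt_comp hc i)).hasFDerivAt.const_smul (l i))

theorem hessL_symm (hf : ContDiffAt ℝ 2 f x) (hc : ContDiffAt ℝ 2 c x) (l : E m) (v w : E n) :
    ⟪hessL f c x l v, w⟫_ℝ = ⟪v, hessL f c x l w⟫_ℝ := by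
  rw [← hess_lagr hf hc]
  exact hess_symm (contDiffAt_lagr hf hc l) v w

/-- The second order Taylor expansion of the Lagrangian at moving base points, with bounded
multipliers. -/
theorem lagr_taylor_isLittleO {α : Type*} {F : Filter α} {xs : E n} (hf : ContDiffAt ℝ 2 f xs)
    (hc : ContDiffAt ℝ 2 c xs) {x s : α → E n} {l : α → E m} (hx : Tendsto x F (𝓝 xs))
    (hs : Tendsto s F (𝓝 0)) (hl : l =O[F] fun _ => (1 : ℝ)) :
    (fun k => lagr f c (x k + s k) (l k) - lagr f c (x k) (l k)
        - ⟪gradient f (x k) + jacT c (x k) (l k), s k⟫_ℝ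
        - 1 / 2 * ⟪s k, hessL f c (x k) (l k) (s k)⟫_ℝ) =o[F] fun k => ‖s k‖ ^ 2 := by
  have hz : Tendsto (fun k => (x k, s k)) F (𝓝 (xs, 0)) := hx.prodMk_nhds hs
  have h1 := (taylor_two_isLittleO hf).comp_tendsto hz
  have h2 : ∀ i, (fun k => l k i * (comp c i (x k + s k) - comp c i (x k)
      - ⟪gradient (comp c i) (x k), s k⟫_ℝ - 1 / 2 * ⟪s k, hess (comp c i) (x k) (s k)⟫_ℝ))
      =o[F] fun k => ‖s k‖ ^ 2 := by
    intro i
    have h3 := (taylor_two_isLittleO (contDiffAt_comp hc i)).comp_tendsto hz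
    have h4 : (fun k => l k i) =O[F] fun _ => (1 : ℝ) :=
      (IsBigO.of_norm_le fun k => PiLp.norm_apply_le (l k) i).trans hl.norm_left
    simpa using h4.mul_isLittleO h3
  refine (h1.add (IsLittleO.fun_sum fun i (_ : i ∈ Finset.univ) => h2 i)).congr' ?_ EventuallyEq.rfl
  filter_upwards [hx.eventually (hc.eventually (by simp))] with k hk
  rw [jacT_eq_sum (hk.differentiableAt (by norm_num))]
  simp only [Function.comp_apply, lagr_eq_sum, hessL, inner_add_left, sum_inner, inner_smul_left,
    add_apply, sum_apply, smul_apply,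
    inner_add_right, inner_sum, inner_smul_right, mul_sub, Finset.sum_sub_distrib, mul_add,
    Finset.mul_sum, conj_trivial]
  have h5 : ∀ i, l k i * (1 / 2 * ⟪s k, hess (comp c i) (x k) (s k)⟫_ℝ)
    = 1 / 2 * (l k i * ⟪s k, hess (comp c i) (x k) (s k)⟫_ℝ) := fun i => by ring
  simp only [h5]
  ring

/-! ### The Jacobian and the projection onto its null space -/

theorem jac_proj (c : E n → E m) (x y : E n) : jac c x (proj c x y) = 0 :=
  ((nullA c x).starProjection_apply_mem y : _)

theorem proj_eq_self {y : E n} (hy : jac c x y = 0) : proj c x y = y :=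
  Submodule.starProjection_eq_self_iff.2 hy

theorem proj_of_mem_range {y : E n} (hy : y ∈ Set.range (proj c x)) :
    proj c x y = y ∧ jac c x y = 0 := by
  obtain ⟨z, rfl⟩ := hy
  exact ⟨proj_eq_self (jac_proj c x z), jac_proj c x z⟩

theorem norm_proj_le (c : E n → E m) (x y : E n) : ‖proj c x y‖ ≤ ‖y‖ :=
  (nullA c x).norm_starProjection_apply_le y

theorem inner_proj (c : E n → E m) (x y z : E n) :
    ⟪proj c x y, z⟫_ℝ = ⟪y, proj c x z⟫_ℝ :=
  (nullA c x).inner_starProjection_left_eq_right y z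

theorem proj_jacT (c : E n → E m) (x : E n) (l : E m) : proj c x (jacT c x l) = 0 := by
  refine ext_inner_right ℝ fun v => ?_
  rw [inner_proj, jacT, ContinuousLinearMap.adjoint_inner_left, jac_proj, inner_zero_right,
    inner_zero_left]

theorem sub_proj_mem_range (c : E n → E m) (x y : E n) :
    y - proj c x y ∈ Set.range (jacT c x) := by
  have h1 : y - proj c x y ∈ (nullA c x)ᗮ := (nullA c x).sub_starProjection_mem_orthogonal y
  have h2 : (nullA c x)ᗮ = LinearMap.range (LinearMap.adjoint (jac c x).toLinearMap) :=
    LinearMap.orthogonal_ker _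
  rw [h2] at h1
  exact h1

/-- On the range of `A(x)ᵀ` the Jacobian is bounded below by its least singular value. -/
theorem norm_le_norm_jac {γ : ℝ} (hγ : 0 ≤ γ) (hA : ∀ y : E m, γ * ‖y‖ ≤ ‖jacT c x y‖) {y : E n}
    (hy : y ∈ Set.range (jacT c x)) : γ * ‖y‖ ≤ ‖jac c x y‖ := by
  obtain ⟨z, rfl⟩ := hy
  rcases eq_or_ne (jacT c x z) 0 with h0 | h0
  · simp [h0]
  have h1 : ‖jacT c x z‖ ^ 2 ≤ ‖z‖ * ‖jac c x (jacT c x z)‖ := by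
    rw [← real_inner_self_eq_norm_sq]
    nth_rewrite 1 [jacT]
    rw [ContinuousLinearMap.adjoint_inner_left]
    exact real_inner_le_norm _ _
  have h2 := norm_pos_iff.2 h0
  refine le_of_mul_le_mul_right ?_ h2
  calc γ * ‖jacT c x z‖ * ‖jacT c x z‖ = γ * ‖jacT c x z‖ ^ 2 := by ring
    _ ≤ γ * (‖z‖ * ‖jac c x (jacT c x z)‖) := by gcongr
    _ = (γ * ‖z‖) * ‖jac c x (jacT c x z)‖ := by ring
    _ ≤ ‖jacT c x z‖ * ‖jac c x (jacT c x z)‖ := by gcongr; exact hA z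
    _ = _ := mul_comm _ _

/-! ### Coercivity of the reduced Hessian -/

/-- An operator that is positive definite on the null space of `A` stays uniformly positive
definite on the null space when both operators are perturbed. -/
theorem exists_pos_eventually_coercive {V W : Type*} [NormedAddCommGroup V]
    [InnerProductSpace ℝ V] [FiniteDimensional ℝ V] [NormedAddCommGroup W] [NormedSpace ℝ W]
    {A : V →L[ℝ] W} {H : V →L[ℝ] V} (hpos : ∀ u, A u = 0 → u ≠ 0 → 0 < ⟪u, H u⟫_ℝ) :
    ∃ κ > 0, ∀ᶠ z : (V →L[ℝ] W) × (V →L[ℝ] V) in 𝓝 (A, H),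
      ∀ u, z.1 u = 0 → κ * ‖u‖ ^ 2 ≤ ⟪u, z.2 u⟫_ℝ := by
  -- The constant is treated as one more parameter, close to `0`, so that compactness of the unit
  -- sphere makes it uniform.
  have h1 : ∀ᶠ z : ((V →L[ℝ] W) × (V →L[ℝ] V)) × ℝ in 𝓝 ((A, H), 0),
      ∀ u ∈ sphere (0 : V) 1, z.1.1 u = 0 → z.2 < ⟪u, z.1.2 u⟫_ℝ := by
    refine (isCompact_sphere (0 : V) 1).eventually_forall_of_forall_eventually fun u hu => ?_
    by_cases hAu : A u = 0
    · have h2 : ContinuousAt (fun z : (((V →L[ℝ] W) × (V →L[ℝ] V)) × ℝ) × V =>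
          ⟪z.2, z.1.1.2 z.2⟫_ℝ - z.1.2) (((A, H), 0), u) := by fun_prop
      have hu0 : u ≠ 0 := by rintro rfl; simp at hu
      filter_upwards [h2.tendsto.eventually_const_lt
        (show (0 : ℝ) < _ by simpa using hpos u hAu hu0)] with z hz _
      linarith
    · have h2 : ContinuousAt (fun z : (((V →L[ℝ] W) × (V →L[ℝ] V)) × ℝ) × V => z.1.1.1 z.2)
        (((A, H), 0), u) := by fun_prop
      filter_upwards [h2.eventually_ne hAu] with z hz h0
      exact absurd h0 hz
  obtain ⟨s, hs, t, ht, hst⟩ := mem_nhds_prod_iff.1 h1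
  obtain ⟨κ, hκ, hκt⟩ : ∃ κ : ℝ, 0 < κ ∧ κ ∈ t := by
    obtain ⟨r, hr, hrt⟩ := Metric.mem_nhds_iff.1 ht
    exact ⟨r / 2, half_pos hr, hrt (by simp [abs_of_pos hr, hr])⟩
  refine ⟨κ, hκ, ?_⟩
  filter_upwards [hs] with z hz u hu
  rcases eq_or_ne u 0 with rfl | hu0
  · simp
  have hn := norm_pos_iff.2 hu0
  have h4 := hst (Set.mk_mem_prod hz hκt) (‖u‖⁻¹ • u)
    (by simp [norm_smul, hn.ne']) (by simp [hu])
  simp only [map_smul, inner_smul_left, inner_smul_right, conj_trivial] at h4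
  have h5 : ‖u‖ ^ 2 * (‖u‖⁻¹ * (‖u‖⁻¹ * ⟪u, z.2 u⟫_ℝ)) = ⟪u, z.2 u⟫_ℝ := by
    field_simp
  nlinarith [mul_lt_mul_of_pos_left h4 (pow_pos hn 2)]

theorem SOSC.inner_pos {xs : E n} {ls : E m} (hs : SOSC f c xs ls) {u : E n}
    (hu : jac c xs u = 0) (h0 : u ≠ 0) : 0 < ⟪u, hess (fun x => lagr f c x ls) xs u⟫_ℝ := by
  obtain ⟨Z, hZ⟩ := hs.reduced_posDef
  set T := hess (fun x => lagr f c x ls) xs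
  let u' : nullA c xs := ⟨u, hu⟩
  have h1 : ∑ i, Z.repr u' i • (Z i : E n) = u := by
    have := congrArg (Subtype.val) (Z.sum_repr u')
    simpa using this
  have h2 : (fun i => Z.repr u' i) ≠ 0 := by
    intro h
    apply h0
    rw [← h1]
    exact Finset.sum_eq_zero fun i _ => by rw [show Z.repr u' i = 0 from congrFun h i, zero_smul]
  have h3 := hZ.dotProduct_mulVec_pos h2
  have h4 : ⟪u, T u⟫_ℝ = ∑ i, Z.repr u' i * ∑ j, ⟪(Z i : E n), T (Z j : E n)⟫_ℝ * Z.repr u' j := by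
    conv_lhs => rw [← h1]
    simp only [map_sum, map_smul, sum_inner, inner_sum, inner_smul_left, inner_smul_right,
      Finset.mul_sum, conj_trivial]
    rw [Finset.sum_comm]
    refine Finset.sum_congr rfl fun i _ => Finset.sum_congr rfl fun j _ => by ring
  rw [h4]
  simpa [dotProduct, Matrix.mulVec] using h3

/-! ### The gradient of the reduced cubic model -/

theorem History.inner_HTilde {h : History n m} {k : ℕ} (hf : ContDiffAt ℝ 2 f (h.x k))
    (hc : ContDiffAt ℝ 2 c (h.x k)) (v w : E n) :
    ⟪h.HTilde f c k v, w⟫_ℝ = ⟪v, h.HTilde f c k w⟫_ℝ := by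
  simp only [History.HTilde, ContinuousLinearMap.comp_apply, History.H]
  rw [inner_proj, hessL_symm hf hc, inner_proj]

theorem History.gradient_mU {h : History n m} {k : ℕ} (hf : ContDiffAt ℝ 2 f (h.x k))
    (hc : ContDiffAt ℝ 2 c (h.x k)) (y : E n) :
    gradient (h.mU f c k) y = h.gTilde f c k + h.HTilde f c k y
      + (h.σ k * ‖proj c (h.x k) y‖) • proj c (h.x k) y := by
  refine HasGradientAt.gradient ?_
  rw [hasGradientAt_iff_hasFDerivAt]
  have h1 := (innerSL ℝ (h.gTilde f c k)).hasFDerivAt (x := y)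
  have h2 := ((hasFDerivAt_id y).inner ℝ ((h.HTilde f c k).hasFDerivAt (x := y))).const_mul
    (1 / 2 : ℝ)
  have h3 := ((hasFDerivAt_norm_rpow (proj c (h.x k) y) (p := 3) (by norm_num)).comp y
    (proj c (h.x k)).hasFDerivAt).const_mul (h.σ k / 3)
  have h4 := (((hasFDerivAt_const (f (h.x k)) y).add h1).add h2).add h3
  have h5 : h.mU f c k = (((fun _ => f (h.x k)) + ⇑(innerSL ℝ (h.gTilde f c k)))
      + fun z => 1 / 2 * ⟪id z, h.HTilde f c k z⟫_ℝ) + fun z => h.σ k / 3 *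
        ((fun w : E n => ‖w‖ ^ (3 : ℝ)) ∘ ⇑(proj c (h.x k))) z := by
    ext z
    simp [History.mU]
  rw [h5]
  refine h4.congr_fderiv ?_
  ext v
  have h6 := History.inner_HTilde hf hc y v
  have h7 : ‖proj c (h.x k) y‖ ^ ((3 : ℝ) - 2) = ‖proj c (h.x k) y‖ := by norm_num
  have h8 : ⟪proj c (h.x k) y, proj c (h.x k) v⟫_ℝ = ⟪proj c (h.x k) y, v⟫_ℝ := by
    rw [← inner_proj, proj_eq_self (jac_proj c _ y)]
  simp only [h7, add_apply, smul_apply, ContinuousLinearMap.comp_apply, innerSL_apply_apply,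
    fderivInnerCLM_apply, ContinuousLinearMap.prod_apply, smul_eq_mul, zero_apply,
    ContinuousLinearMap.id_apply, id, InnerProductSpace.toDual_apply_apply, inner_add_left,
    inner_smul_left, conj_trivial, h8, h6]
  rw [real_inner_comm _ v, h6]
  ring

end

/-! ### Elementary properties of a convergent run -/

/-- A run of the algorithm on `(f, c)` whose iterates stay in the open convex set `X`, where the
smoothness and regularity assumptions hold, and converge to a point `xs` that satisfies the second
order sufficient conditions with multiplier `ls`. -/
structure ConvergentRun {n m : ℕ} (f : E n → ℝ) (c : E n → E m) (p : Params) (h : History n m)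
    (X : Set (E n)) (xs : E n) (ls : E m) : Prop where
  valid : p.Valid
  run : h.IsRun f c p
  isOpen : IsOpen X
  convex : Convex ℝ X
  mem : ∀ k, h.x k ∈ X
  f1 : F1 f c X
  f2 : F2 c X
  f3 : F3 f c h
  f5 : F5 f c X
  f_smooth : ContDiffAt ℝ 2 f xs
  c_smooth : ContDiffAt ℝ 2 c xs
  lim : Tendsto h.x atTop (𝓝 xs)
  sosc : SOSC f c xs ls

namespace ConvergentRun

variable {n m : ℕ} {f : E n → ℝ} {c : E n → E m} {p : Params} {h : History n m}
  {X : Set (E n)} {xs : E n} {ls : E m}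

theorem contDiffAt_f (R : ConvergentRun f c p h X xs ls) (k : ℕ) : ContDiffAt ℝ 2 f (h.x k) :=
  R.f1.f_smooth.contDiffAt (R.isOpen.mem_nhds (R.mem k))

theorem contDiffAt_c (R : ConvergentRun f c p h X xs ls) (k : ℕ) : ContDiffAt ℝ 2 c (h.x k) :=
  R.f1.c_smooth.contDiffAt (R.isOpen.mem_nhds (R.mem k))

theorem sigmaMin_le (R : ConvergentRun f c p h X xs ls) (k : ℕ) : p.sigmaMin ≤ h.σ k := by
  induction k with
  | zero => exact R.run.sigma_init
  | succ k ih =>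
    rcases lt_or_ge (h.ratio f c p k) p.η₁ with h1 | h1
    · have h2 := (R.run.sigma_unsuccessful k h1).1
      nlinarith [R.valid.γ₁_gt, R.valid.sigmaMin_pos]
    · rcases le_or_gt (h.ratio f c p k) p.η₂ with h2 | h2
      · rw [R.run.sigma_successful k h1 h2]; exact ih
      · exact (le_max_left _ _).trans (R.run.sigma_very_successful k h2).1

theorem sigma_pos (R : ConvergentRun f c p h X xs ls) (k : ℕ) : 0 < h.σ k :=
  R.valid.sigmaMin_pos.trans_le (R.sigmaMin_le k)

/-- At an infeasible point the normal step cannot vanish, since the bound on its residual contains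
`‖v_kᶜ‖³`. -/
theorem vc_ne_zero (R : ConvergentRun f c p h X xs ls) {k : ℕ} (hc : c (h.x k) ≠ 0) :
    h.vc k ≠ 0 := by
  intro h0
  have h1 := (R.run.normal k).residual
  rw [h0] at h1
  have h2 : min (l1 (c (h.x k))) (‖(0 : E n)‖ ^ 3) = 0 := by simp [l1_nonneg]
  rw [h2, mul_zero, map_zero, zero_add] at h1
  exact hc (l1_eq_zero.1 (le_antisymm h1 (l1_nonneg _)))

theorem beta_pos (R : ConvergentRun f c p h X xs ls) (k : ℕ) : 0 < h.β k := by
  by_cases hc : c (h.x k) = 0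
  · rw [((R.run.normal k).feasible hc).2]; exact one_pos
  · have h1 := norm_pos_iff.2 (R.vc_ne_zero hc)
    have h2 := Real.sqrt_pos.2 (R.sigma_pos k)
    exact (lt_min one_pos (div_pos R.valid.θ_mem.1 (by positivity))).trans_le
      ((R.run.normal k).infeasible hc).1

theorem beta_le_one (R : ConvergentRun f c p h X xs ls) (k : ℕ) : h.β k ≤ 1 := by
  by_cases hc : c (h.x k) = 0
  · rw [((R.run.normal k).feasible hc).2]
  · exact ((R.run.normal k).infeasible hc).2.trans (min_le_left _ _)

theorem norm_v (R : ConvergentRun f c p h X xs ls) (k : ℕ) : ‖h.v k‖ = h.β k * ‖h.vc k‖ := by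
  rw [History.v, norm_smul, Real.norm_eq_abs, abs_of_pos (R.beta_pos k)]

theorem norm_v_le (R : ConvergentRun f c p h X xs ls) (k : ℕ) : ‖h.v k‖ ≤ ‖h.vc k‖ := by
  rw [R.norm_v]
  exact mul_le_of_le_one_left (norm_nonneg _) (R.beta_le_one k)

/-- The full normal step is taken unless `‖v_kᶜ‖` is large compared with `1 / √σ_k`. -/
theorem beta_eq_one (R : ConvergentRun f c p h X xs ls) {k : ℕ}
    (hk : ‖h.vc k‖ * √(h.σ k) ≤ p.θ) : h.β k = 1 := by
  by_cases hc : c (h.x k) = 0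
  · exact ((R.run.normal k).feasible hc).2
  · have h1 := norm_pos_iff.2 (R.vc_ne_zero hc)
    have h2 := Real.sqrt_pos.2 (R.sigma_pos k)
    refine le_antisymm (R.beta_le_one k) ?_
    have h3 : 1 ≤ p.θ / (‖h.vc k‖ * √(h.σ k)) := (one_le_div (by positivity)).2 hk
    exact (min_eq_left h3).symm.le.trans ((R.run.normal k).infeasible hc).1

theorem sigma_mul_norm_v_sq_le (R : ConvergentRun f c p h X xs ls) (k : ℕ) :
    h.σ k * ‖h.v k‖ ^ 2 ≤ 1 := by
  by_cases hc : c (h.x k) = 0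
  · simp [History.v, ((R.run.normal k).feasible hc).1]
  · have h1 := norm_pos_iff.2 (R.vc_ne_zero hc)
    have h2 := Real.sqrt_pos.2 (R.sigma_pos k)
    have h3 := ((R.run.normal k).infeasible hc).2.trans (min_le_right _ _)
    rw [le_div_iff₀ (by positivity)] at h3
    have h4 : ‖h.v k‖ * √(h.σ k) ≤ 1 := by rw [R.norm_v]; linarith
    have h5 := pow_le_one₀ (n := 2) (by positivity) h4
    rw [mul_pow, Real.sq_sqrt (R.sigma_pos k).le] at h5
    linarith

theorem residual_le (R : ConvergentRun f c p h X xs ls) (k : ℕ) :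
    l1 (jac c (h.x k) (h.vc k) + c (h.x k)) ≤ p.rv * l1 (c (h.x k)) :=
  (R.run.normal k).residual.trans
    (mul_le_mul_of_nonneg_left (min_le_left _ _) R.valid.rv_mem.1)

theorem residual_le_cube (R : ConvergentRun f c p h X xs ls) (k : ℕ) :
    ‖jac c (h.x k) (h.vc k) + c (h.x k)‖ ≤ p.rv * ‖h.vc k‖ ^ 3 :=
  (norm_le_l1 _).trans ((R.run.normal k).residual.trans
    (mul_le_mul_of_nonneg_left (min_le_right _ _) R.valid.rv_mem.1))

theorem exists_norm_vc_le (R : ConvergentRun f c p h X xs ls) :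
    ∃ K > 0, ∀ k, ‖h.vc k‖ ≤ K * l1 (c (h.x k)) := by
  obtain ⟨γ, hγ, hA⟩ := R.f2
  refine ⟨2 / γ, by positivity, fun k => ?_⟩
  have h1 := norm_le_norm_jac hγ.le (hA _ (R.mem k)) (R.run.normal k).mem_range
  have h2 : ‖jac c (h.x k) (h.vc k)‖ ≤ 2 * l1 (c (h.x k)) := by
    calc ‖jac c (h.x k) (h.vc k)‖
        = ‖(jac c (h.x k) (h.vc k) + c (h.x k)) - c (h.x k)‖ := by rw [add_sub_cancel_right]
      _ ≤ ‖jac c (h.x k) (h.vc k) + c (h.x k)‖ + ‖c (h.x k)‖ := norm_sub_le _ _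
      _ ≤ p.rv * l1 (c (h.x k)) + l1 (c (h.x k)) :=
        add_le_add ((norm_le_l1 _).trans (R.residual_le k)) (norm_le_l1 _)
      _ ≤ 2 * l1 (c (h.x k)) := by
        nlinarith [l1_nonneg (c (h.x k)), R.valid.rv_mem.2, R.valid.τ_mem.1]
  rw [div_mul_eq_mul_div, le_div_iff₀ hγ]
  linarith

theorem u_spec (R : ConvergentRun f c p h X xs ls) (k : ℕ) :
    proj c (h.x k) (h.u k) = h.u k ∧ jac c (h.x k) (h.u k) = 0 :=
  proj_of_mem_range (R.run.tangential k).mem_range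

theorem jac_d (R : ConvergentRun f c p h X xs ls) (k : ℕ) :
    jac c (h.x k) (h.d k) = jac c (h.x k) (h.v k) := by
  rw [History.d, map_add, (R.u_spec k).2, add_zero]

/-- The gradient of the reduced model at the tangential step, as a projected Newton residual. -/
theorem gradient_mU_u (R : ConvergentRun f c p h X xs ls) (k : ℕ) :
    gradient (h.mU f c k) (h.u k) =
      proj c (h.x k) (gradient f (h.x k) + h.H f c k (h.d k)) + (h.σ k * ‖h.u k‖) • h.u k := by
  rw [History.gradient_mU (R.contDiffAt_f k) (R.contDiffAt_c k)]
  simp only [History.gTilde, History.HTilde, ContinuousLinearMap.comp_apply, (R.u_spec k).1,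
    History.d, map_add, add_assoc]

/-! ### Asymptotics of the normal step and of the multipliers -/

theorem tendsto_jac (R : ConvergentRun f c p h X xs ls) :
    Tendsto (fun k => jac c (h.x k)) atTop (𝓝 (jac c xs)) :=
  ((R.c_smooth.fderiv_right (m := 0) (by norm_num)).continuousAt.tendsto.comp R.lim)

theorem jac_isBigO_one (R : ConvergentRun f c p h X xs ls) :
    (fun k => jac c (h.x k)) =O[atTop] fun _ => (1 : ℝ) :=
  R.tendsto_jac.isBigO_one ℝ

/-- Applying the Jacobian preserves `O`-bounds. -/
theorem jac_apply_isBigO (R : ConvergentRun f c p h X xs ls) {l : Filter ℕ} (hl : l ≤ atTop)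
    (y : ℕ → E n) : (fun k => jac c (h.x k) (y k)) =O[l] y :=
  isBigO_clm_apply (R.jac_isBigO_one.mono hl) y

/-- On the ranges of `A_kᵀ` the Jacobians are uniformly bounded below. -/
theorem isBigO_jac_apply (R : ConvergentRun f c p h X xs ls) {l : Filter ℕ}
    {y : ℕ → E n} (hy : ∀ᶠ k in l, y k ∈ Set.range (jacT c (h.x k))) :
    y =O[l] fun k => jac c (h.x k) (y k) := by
  obtain ⟨γ, hγ, hA⟩ := R.f2
  refine IsBigO.of_bound γ⁻¹ (hy.mono fun k hk => ?_)
  rw [inv_mul_eq_div, le_div_iff₀ hγ, mul_comm]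
  exact norm_le_norm_jac hγ.le (hA _ (R.mem k)) hk

theorem tendsto_sub (R : ConvergentRun f c p h X xs ls) :
    Tendsto (fun k => h.x k - xs) atTop (𝓝 0) := by
  simpa using R.lim.sub_const xs

theorem c_isBigO (R : ConvergentRun f c p h X xs ls) :
    (fun k => c (h.x k)) =O[atTop] fun k => h.x k - xs := by
  have h1 := ((R.c_smooth.differentiableAt (by norm_num)).hasFDerivAt.isBigO_sub).comp_tendsto
    R.lim
  simpa [R.sosc.feasible, Function.comp_def] using h1

theorem vc_isBigO_c (R : ConvergentRun f c p h X xs ls) :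
    h.vc =O[atTop] fun k => c (h.x k) := by
  obtain ⟨K, hK, hvc⟩ := R.exists_norm_vc_le
  refine IsBigO.of_bound (K * m) (Eventually.of_forall fun k => ?_)
  rw [mul_assoc]
  exact (hvc k).trans (mul_le_mul_of_nonneg_left (l1_le_mul_norm _) hK.le)

theorem vc_isBigO (R : ConvergentRun f c p h X xs ls) :
    h.vc =O[atTop] fun k => h.x k - xs := R.vc_isBigO_c.trans R.c_isBigO

theorem v_isBigO (R : ConvergentRun f c p h X xs ls) :
    h.v =O[atTop] fun k => h.x k - xs :=
  (IsBigO.of_norm_le fun k => R.norm_v_le k).trans R.vc_isBigO.norm_left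

theorem gradLagr_isBigO (R : ConvergentRun f c p h X xs ls) :
    (fun k => gradient f (h.x k) + jacT c (h.x k) ls) =O[atTop] fun k => h.x k - xs := by
  have h1 := (differentiableAt_gradient (contDiffAt_lagr R.f_smooth R.c_smooth ls)
    ).hasFDerivAt.isBigO_sub.comp_tendsto R.lim
  refine h1.congr (fun k => ?_) fun k => rfl
  simp only [Function.comp_apply]
  rw [R.sosc.stationary, sub_zero, gradient_lagr
    ((R.contDiffAt_f k).differentiableAt (by norm_num))
    ((R.contDiffAt_c k).differentiableAt (by norm_num))]

/-- The dual variables converge to the Lagrange multiplier, linearly in the distance to the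
solution: `A_k A_kᵀ (λ_k - λ*)` is a difference of two small residuals. -/
theorem lam_sub_isBigO (R : ConvergentRun f c p h X xs ls) :
    (fun k => h.lam k - ls) =O[atTop] fun k => h.x k - xs := by
  obtain ⟨γ, hγ, hA⟩ := R.f2
  have h1 : (fun k => h.lam k - ls) =O[atTop] fun k => jacT c (h.x k) (h.lam k - ls) := by
    refine IsBigO.of_bound γ⁻¹ (Eventually.of_forall fun k => ?_)
    rw [inv_mul_eq_div, le_div_iff₀ hγ, mul_comm]
    exact hA _ (R.mem k) _
  have h2 := R.isBigO_jac_apply (l := atTop) (y := fun k => jacT c (h.x k) (h.lam k - ls))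
    (Eventually.of_forall fun k => ⟨_, rfl⟩)
  refine (h1.trans h2).trans ?_
  have h3 : (fun k => jac c (h.x k) (gradient f (h.x k) + jacT c (h.x k) (h.lam k)))
      =O[atTop] fun k => h.x k - xs :=
    (IsBigO.of_bound p.rlam (Eventually.of_forall R.run.dual)).trans R.v_isBigO
  refine (h3.sub ((R.jac_apply_isBigO le_rfl _).trans R.gradLagr_isBigO)).congr
    (fun k => ?_) fun k => rfl
  rw [← map_sub, map_sub (jacT c (h.x k))]
  congr 1
  abel

theorem tendsto_lam (R : ConvergentRun f c p h X xs ls) : Tendsto h.lam atTop (𝓝 ls) := by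
  simpa using (R.lam_sub_isBigO.trans_tendsto R.tendsto_sub).add_const ls

theorem jacT_apply_isBigO (R : ConvergentRun f c p h X xs ls) (y : ℕ → E m) :
    (fun k => jacT c (h.x k) (y k)) =O[atTop] y := by
  refine isBigO_clm_apply (IsBigO.trans (IsBigO.of_norm_le fun k => ?_)
    R.jac_isBigO_one.norm_left) y
  rw [jacT, LinearIsometryEquiv.norm_map]

theorem gradLagr_lam_isBigO (R : ConvergentRun f c p h X xs ls) :
    (fun k => gradient f (h.x k) + jacT c (h.x k) (h.lam k)) =O[atTop] fun k => h.x k - xs := by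
  refine (R.gradLagr_isBigO.add ((R.jacT_apply_isBigO _).trans R.lam_sub_isBigO)).congr
    (fun k => ?_) fun k => rfl
  rw [map_sub]
  abel

theorem H_isBigO_one (R : ConvergentRun f c p h X xs ls) {l : Filter ℕ} :
    (h.H f c) =O[l] fun _ => (1 : ℝ) := by
  obtain ⟨κ, -, hκ⟩ := R.f3
  exact IsBigO.of_bound κ (Eventually.of_forall fun k => by simpa using hκ k)

theorem H_apply_isBigO (R : ConvergentRun f c p h X xs ls) {l : Filter ℕ} (y : ℕ → E n) :
    (fun k => h.H f c k (y k)) =O[l] y :=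
  isBigO_clm_apply R.H_isBigO_one y

theorem gTilde_isBigO (R : ConvergentRun f c p h X xs ls) :
    (h.gTilde f c) =O[atTop] fun k => h.x k - xs := by
  refine (IsBigO.of_norm_le fun k => ?_).trans
    (R.gradLagr_lam_isBigO.add ((R.H_apply_isBigO h.v).trans R.v_isBigO)).norm_left
  have h1 : h.gTilde f c k = proj c (h.x k)
      (gradient f (h.x k) + jacT c (h.x k) (h.lam k) + h.H f c k (h.v k)) := by
    simp only [History.gTilde, map_add, proj_jacT, add_zero]
  rw [h1]
  exact norm_proj_le _ _ _

/-! ### Coercivity along the run -/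

theorem tendsto_H (R : ConvergentRun f c p h X xs ls) :
    Tendsto (h.H f c) atTop (𝓝 (hessL f c xs ls)) := by
  refine ((continuousAt_hess R.f_smooth).tendsto.comp R.lim).add (tendsto_finsetSum _
    fun i _ => ?_)
  exact (((EuclideanSpace.proj (𝕜 := ℝ) i).continuous.tendsto ls).comp R.tendsto_lam).smul
    ((continuousAt_hess (contDiffAt_comp R.c_smooth i)).tendsto.comp R.lim)

theorem exists_coercive (R : ConvergentRun f c p h X xs ls) :
    ∃ κ > 0, ∀ᶠ k in atTop, ∀ y, jac c (h.x k) y = 0 → κ * ‖y‖ ^ 2 ≤ ⟪y, h.H f c k y⟫_ℝ := by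
  obtain ⟨κ, hκ, h1⟩ := exists_pos_eventually_coercive (A := jac c xs)
    (H := hessL f c xs ls) fun u hu h0 => by
      rw [← hess_lagr R.f_smooth R.c_smooth]
      exact R.sosc.inner_pos hu h0
  exact ⟨κ, hκ, (R.tendsto_jac.prodMk_nhds R.tendsto_H).eventually h1⟩

/-- Near the solution the approximate stationarity of the tangential step alone bounds its length
by the reduced gradient and guarantees a quadratic decrease of the model. -/
theorem exists_tangential_bounds (R : ConvergentRun f c p h X xs ls) :
    ∃ κ > 0, ∀ᶠ k in atTop, κ * ‖h.u k‖ ≤ ‖h.gTilde f c k‖ ∧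
      h.σ k * ‖h.u k‖ ^ 2 ≤ 2 * ‖h.gTilde f c k‖ ∧
      κ / 2 * ‖h.u k‖ ^ 2 ≤ h.deltaM f c k (h.u k) := by
  obtain ⟨κ, hκ, h1⟩ := R.exists_coercive
  refine ⟨κ, hκ, ?_⟩
  filter_upwards [h1] with k hk
  obtain ⟨hu, hAu⟩ := R.u_spec k
  have hcoer := hk _ hAu
  have hσ := R.sigma_pos k
  have hHT : ⟪h.u k, h.HTilde f c k (h.u k)⟫_ℝ = ⟪h.u k, h.H f c k (h.u k)⟫_ℝ := by
    simp only [History.HTilde, ContinuousLinearMap.comp_apply]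
    rw [← inner_proj, hu]
  -- the gradient of the model is tested with `u_k` itself
  have hr : ⟪gradient (h.mU f c k) (h.u k), h.u k⟫_ℝ = ⟪h.gTilde f c k, h.u k⟫_ℝ
      + ⟪h.u k, h.H f c k (h.u k)⟫_ℝ + h.σ k * ‖h.u k‖ ^ 3 := by
    rw [History.gradient_mU (R.contDiffAt_f k) (R.contDiffAt_c k), inner_add_left, inner_add_left,
      real_inner_comm, hu, real_inner_comm (h.u k) (h.HTilde f c k (h.u k)), hHT,
      inner_smul_left, real_inner_self_eq_norm_sq, real_inner_comm]
    simp only [conj_trivial]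
    ring
  have hr' : |⟪gradient (h.mU f c k) (h.u k), h.u k⟫_ℝ| ≤ p.δ * h.σ k * ‖h.u k‖ ^ 3 := by
    refine (abs_real_inner_le_norm _ _).trans ?_
    have := mul_le_mul_of_nonneg_right (R.run.tangential k).gradient_le (norm_nonneg (h.u k))
    nlinarith
  have hg := (abs_le.1 (abs_real_inner_le_norm (h.gTilde f c k) (h.u k))).1
  have hδ := R.valid.δ_mem
  have h3 : 0 ≤ h.σ k * ‖h.u k‖ ^ 3 := by positivity
  have h4 : p.δ * h.σ k * ‖h.u k‖ ^ 3 ≤ 1 / 6 * (h.σ k * ‖h.u k‖ ^ 3) := by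
    rw [mul_assoc]; exact mul_le_mul_of_nonneg_right hδ.2.le h3
  obtain ⟨hr1, hr2⟩ := abs_le.1 hr'
  have hdm : h.deltaM f c k (h.u k) = -⟪h.gTilde f c k, h.u k⟫_ℝ
      - 1 / 2 * ⟪h.u k, h.H f c k (h.u k)⟫_ℝ - h.σ k / 3 * ‖h.u k‖ ^ 3 := by
    simp only [History.deltaM, History.mU, hHT, hu, map_zero, inner_zero_right, norm_zero]
    ring
  have hκu : 0 ≤ κ * ‖h.u k‖ ^ 2 := by positivity
  refine ⟨?_, ?_, by rw [hdm]; linarith⟩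
  · rcases (norm_nonneg (h.u k)).eq_or_lt with h0 | h0
    · rw [← h0, mul_zero]; exact norm_nonneg _
    · refine le_of_mul_le_mul_right ?_ h0
      nlinarith
  · rcases (norm_nonneg (h.u k)).eq_or_lt with h0 | h0
    · rw [← h0]; simp
    · refine le_of_mul_le_mul_right ?_ h0
      nlinarith

theorem u_isBigO (R : ConvergentRun f c p h X xs ls) :
    h.u =O[atTop] fun k => h.x k - xs := by
  obtain ⟨κ, hκ, h1⟩ := R.exists_tangential_bounds
  refine IsBigO.trans (IsBigO.of_bound κ⁻¹ (h1.mono fun k hk => ?_)) R.gTilde_isBigO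
  rw [inv_mul_eq_div, le_div_iff₀ hκ, mul_comm]
  exact hk.1

theorem d_isBigO (R : ConvergentRun f c p h X xs ls) :
    h.d =O[atTop] fun k => h.x k - xs := R.v_isBigO.add R.u_isBigO

theorem tendsto_d (R : ConvergentRun f c p h X xs ls) : Tendsto h.d atTop (𝓝 0) :=
  R.d_isBigO.trans_tendsto R.tendsto_sub

/-! ### The merit parameter and the predicted reduction -/

theorem muInit_le_muPrev (R : ConvergentRun f c p h X xs ls) (k : ℕ) :
    p.muInit ≤ h.muPrev p k := by
  induction k with
  | zero => exact le_rfl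
  | succ k ih =>
    change p.muInit ≤ h.μ k
    rw [R.run.merit_update k]
    split_ifs with h1
    · nlinarith [R.valid.ν_gt, R.valid.muInit_pos]
    · exact ih

theorem muInit_le_mu (R : ConvergentRun f c p h X xs ls) (k : ℕ) : p.muInit ≤ h.μ k :=
  R.muInit_le_muPrev (k + 1)

theorem mu_pos (R : ConvergentRun f c p h X xs ls) (k : ℕ) : 0 < h.μ k :=
  R.valid.muInit_pos.trans_le (R.muInit_le_mu k)

theorem muC_le_mu (R : ConvergentRun f c p h X xs ls) (k : ℕ) : h.muC f c p k ≤ h.μ k := by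
  rw [R.run.merit_update k]
  split_ifs with h1
  · nlinarith [R.valid.ν_gt, R.valid.muInit_pos, R.muInit_le_muPrev k]
  · exact not_lt.1 h1

/-- The merit parameter is large enough for the predicted reduction of the merit model to
dominate the reductions of the tangential model and of the linearized infeasibility. -/
theorem deltaQ_ge (R : ConvergentRun f c p h X xs ls) (k : ℕ) :
    h.deltaM f c k (h.u k) + p.τ * h.μ k * h.β k * l1 (c (h.x k)) ≤ h.deltaQ f c k := by
  obtain ⟨hu, hAu⟩ := R.u_spec k
  have hβ := R.beta_pos k
  -- the numerator of `μ_kᶜ`, that is, the part of the increase of the cubic model due to `v_k`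
  set N := ⟪gradient f (h.x k), h.v k⟫_ℝ + 1 / 2 * ⟪h.v k, h.H f c k (h.v k)⟫_ℝ
    + h.σ k / 3 * (‖h.d k‖ ^ 3 - ‖h.u k‖ ^ 3) with hN
  have hgT : ⟪h.gTilde f c k, h.u k⟫_ℝ
      = ⟪gradient f (h.x k), h.u k⟫_ℝ + ⟪h.v k, h.H f c k (h.u k)⟫_ℝ := by
    rw [History.gTilde, inner_proj, hu, inner_add_left, History.H,
      hessL_symm (R.contDiffAt_f k) (R.contDiffAt_c k)]
  have hHT : ⟪h.u k, h.HTilde f c k (h.u k)⟫_ℝ = ⟪h.u k, h.H f c k (h.u k)⟫_ℝ := by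
    simp only [History.HTilde, ContinuousLinearMap.comp_apply]
    rw [← inner_proj, hu]
  have hsym : ⟪h.u k, h.H f c k (h.v k)⟫_ℝ = ⟪h.v k, h.H f c k (h.u k)⟫_ℝ := by
    rw [real_inner_comm, History.H, hessL_symm (R.contDiffAt_f k) (R.contDiffAt_c k)]
  have h1 : h.deltaQ f c k = h.deltaM f c k (h.u k) - N
      + h.μ k * (l1 (c (h.x k)) - l1 (c (h.x k) + jac c (h.x k) (h.v k))) := by
    simp only [History.deltaQ, History.q, History.deltaM, History.mU, R.jac_d, hN, hHT, hgT, hu,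
      map_zero, inner_zero_right, norm_zero, add_zero]
    simp only [History.d, map_add, inner_add_left, inner_add_right, hsym]
    ring
  -- `c_k + A_k v_k` is a convex combination of `c_k` and of the residual of the normal step
  have h2 : l1 (c (h.x k) + jac c (h.x k) (h.v k))
      ≤ (1 - h.β k + h.β k * p.rv) * l1 (c (h.x k)) := by
    have h3 : c (h.x k) + jac c (h.x k) (h.v k) = (1 - h.β k) • c (h.x k)
        + h.β k • (jac c (h.x k) (h.vc k) + c (h.x k)) := by
      rw [History.v, map_smul]; module
    rw [h3]
    refine (l1_add_le _ _).trans ?_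
    rw [l1_smul, l1_smul, abs_of_nonneg (sub_nonneg.2 (R.beta_le_one k)), abs_of_pos hβ]
    nlinarith [mul_le_mul_of_nonneg_left (R.residual_le k) hβ.le]
  have h4 : N ≤ h.μ k * ((1 - p.rv - p.τ) * h.β k * l1 (c (h.x k))) := by
    by_cases hc : c (h.x k) = 0
    · have hv : h.v k = 0 := by rw [History.v, ((R.run.normal k).feasible hc).1, smul_zero]
      simp [hN, hc, hv, l1_zero, History.d]
    · have h5 : l1 (c (h.x k)) ≠ 0 := fun h0 => hc (l1_eq_zero.1 h0)
      have h6 : 0 < l1 (c (h.x k)) := (l1_nonneg _).lt_of_ne' h5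
      have h7 : 0 < 1 - p.rv - p.τ := by linarith [R.valid.rv_mem.2]
      rw [← div_le_iff₀ (by positivity)]
      have h8 := R.muC_le_mu k
      rwa [History.muC, if_neg h5] at h8
  rw [h1]
  have h5 := mul_le_mul_of_nonneg_left h2 (R.mu_pos k).le
  nlinarith

/-- The predicted reduction is bounded below by the squared length of the tangential step and by
the length of the normal step. -/
theorem exists_deltaQ_coercive (R : ConvergentRun f c p h X xs ls) :
    ∃ κ > 0, ∀ᶠ k in atTop, κ * (‖h.u k‖ ^ 2 + (1 + h.μ k) * ‖h.v k‖) ≤ h.deltaQ f c k := by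
  obtain ⟨κ, hκ, h1⟩ := R.exists_tangential_bounds
  obtain ⟨K, hK, hvc⟩ := R.exists_norm_vc_le
  have hτ := R.valid.τ_mem.1
  have hμ0 := R.valid.muInit_pos
  -- `1 + μ_k` is at most a constant multiple of `μ_k`
  let a := p.τ / K * (p.muInit / (1 + p.muInit))
  have ha : 0 < a := by positivity
  refine ⟨min (κ / 2) a, lt_min (by positivity) ha, ?_⟩
  filter_upwards [h1] with k ⟨_, _, hk⟩
  refine le_trans ?_ (R.deltaQ_ge k)
  have hμ := R.mu_pos k
  have hβ := R.beta_pos k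
  have h2 : a * ((1 + h.μ k) * ‖h.v k‖) ≤ p.τ * h.μ k * h.β k * l1 (c (h.x k)) := by
    have h3 : p.muInit / (1 + p.muInit) * (1 + h.μ k) ≤ h.μ k := by
      rw [div_mul_eq_mul_div, div_le_iff₀ (by positivity)]
      nlinarith [R.muInit_le_mu k]
    have h4 : ‖h.v k‖ ≤ h.β k * (K * l1 (c (h.x k))) := by
      rw [R.norm_v]; exact mul_le_mul_of_nonneg_left (hvc k) hβ.le
    calc a * ((1 + h.μ k) * ‖h.v k‖)
        = p.τ / K * (p.muInit / (1 + p.muInit) * (1 + h.μ k)) * ‖h.v k‖ := by simp only [a]; ring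
      _ ≤ p.τ / K * h.μ k * (h.β k * (K * l1 (c (h.x k)))) := by gcongr
      _ = _ := by field_simp
  have h5 : min (κ / 2) a * ‖h.u k‖ ^ 2 ≤ κ / 2 * ‖h.u k‖ ^ 2 := by gcongr; exact min_le_left _ _
  have h6 : min (κ / 2) a * ((1 + h.μ k) * ‖h.v k‖) ≤ a * ((1 + h.μ k) * ‖h.v k‖) := by
    gcongr; exact min_le_right _ _
  linarith

/-- The numerator of `μ_kᶜ` is `O(‖v_k‖)`, because `σ_k ‖v_k‖²` and `σ_k ‖u_k‖²` are bounded, while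
`‖v_k‖` is at most a multiple of `β_k ‖c_k‖₁`. -/
theorem exists_muC_le (R : ConvergentRun f c p h X xs ls) :
    ∃ K : ℝ, ∀ᶠ k in atTop, h.muC f c p k ≤ K := by
  obtain ⟨κ, hκ, h1⟩ := R.exists_tangential_bounds
  obtain ⟨K, hK, hvc⟩ := R.exists_norm_vc_le
  obtain ⟨κH, hκH, hH⟩ := R.f3
  obtain ⟨κg, hκg⟩ := R.f1.g_bdd
  have h7 : 0 < 1 - p.rv - p.τ := by linarith [R.valid.rv_mem.2]
  have hv : Tendsto h.v atTop (𝓝 0) := R.v_isBigO.trans_tendsto R.tendsto_sub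
  have hg : Tendsto (h.gTilde f c) atTop (𝓝 0) := R.gTilde_isBigO.trans_tendsto R.tendsto_sub
  have hv1 := hv.norm.eventually_lt_const (u := 1) (by simp)
  have hg1 := hg.norm.eventually_lt_const (u := 1) (by simp)
  have hκg0 : 0 ≤ κg := (norm_nonneg _).trans (hκg _ (R.mem 0))
  refine ⟨(κg + κH + 5) * K / (1 - p.rv - p.τ), ?_⟩
  filter_upwards [h1, hv1, hg1] with k ⟨_, hk, _⟩ hvk hgk
  unfold History.muC
  split_ifs with h0
  · positivity
  have h6 : 0 < l1 (c (h.x k)) := (l1_nonneg _).lt_of_ne' h0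
  have hβ := R.beta_pos k
  have hσ := R.sigma_pos k
  rw [div_le_div_iff₀ (by positivity) h7]
  have hvK : ‖h.v k‖ ≤ h.β k * (K * l1 (c (h.x k))) := by
    rw [R.norm_v]; exact mul_le_mul_of_nonneg_left (hvc k) hβ.le
  have e1 : ⟪gradient f (h.x k), h.v k⟫_ℝ ≤ κg * ‖h.v k‖ :=
    (real_inner_le_norm _ _).trans
      (mul_le_mul_of_nonneg_right (hκg _ (R.mem k)) (norm_nonneg _))
  have e2 : ⟪h.v k, h.H f c k (h.v k)⟫_ℝ ≤ κH * ‖h.v k‖ := by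
    refine (real_inner_le_norm _ _).trans ?_
    calc ‖h.v k‖ * ‖h.H f c k (h.v k)‖ ≤ 1 * (κH * ‖h.v k‖) := by
          gcongr
          exact ((h.H f c k).le_opNorm _).trans
            (mul_le_mul_of_nonneg_right (hH k) (norm_nonneg _))
      _ = _ := one_mul _
  have e3 : h.σ k / 3 * (‖h.d k‖ ^ 3 - ‖h.u k‖ ^ 3) ≤ 5 * ‖h.v k‖ := by
    have e4 : ‖h.d k‖ ^ 3 ≤ (‖h.v k‖ + ‖h.u k‖) ^ 3 := by
      gcongr; exact norm_add_le _ _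
    have e5 : (‖h.v k‖ + ‖h.u k‖) ^ 3 - ‖h.u k‖ ^ 3
        ≤ 5 * ‖h.v k‖ * (‖h.u k‖ ^ 2 + ‖h.v k‖ ^ 2) := by
      nlinarith [mul_nonneg (norm_nonneg (h.v k)) (sq_nonneg (‖h.u k‖ - ‖h.v k‖)),
        pow_nonneg (norm_nonneg (h.v k)) 3,
        mul_nonneg (norm_nonneg (h.v k)) (sq_nonneg (‖h.u k‖))]
    have e6 : h.σ k * (‖h.u k‖ ^ 2 + ‖h.v k‖ ^ 2) ≤ 3 := by
      linarith [R.sigma_mul_norm_v_sq_le k]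
    calc h.σ k / 3 * (‖h.d k‖ ^ 3 - ‖h.u k‖ ^ 3)
        ≤ h.σ k / 3 * (5 * ‖h.v k‖ * (‖h.u k‖ ^ 2 + ‖h.v k‖ ^ 2)) := by gcongr; linarith
      _ = 5 / 3 * ‖h.v k‖ * (h.σ k * (‖h.u k‖ ^ 2 + ‖h.v k‖ ^ 2)) := by ring
      _ ≤ 5 / 3 * ‖h.v k‖ * 3 := by gcongr
      _ = _ := by ring
  have e7 : ⟪gradient f (h.x k), h.v k⟫_ℝ + 1 / 2 * ⟪h.v k, h.H f c k (h.v k)⟫_ℝ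
      + h.σ k / 3 * (‖h.d k‖ ^ 3 - ‖h.u k‖ ^ 3) ≤ (κg + κH + 5) * ‖h.v k‖ := by
    nlinarith [norm_nonneg (h.v k)]
  calc _ ≤ (κg + κH + 5) * (h.β k * (K * l1 (c (h.x k)))) * (1 - p.rv - p.τ) := by
        gcongr
        exact e7.trans (by gcongr)
    _ = _ := by ring

theorem mu_isBigO_one (R : ConvergentRun f c p h X xs ls) :
    h.μ =O[atTop] fun _ => (1 : ℝ) := by
  obtain ⟨K, hK⟩ := R.exists_muC_le
  obtain ⟨N, hN⟩ := eventually_atTop.1 hK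
  have h1 : ∀ k ≥ N, h.μ k ≤ max (h.μ N) (p.ν * K) := by
    intro k hk
    induction k, hk using Nat.le_induction with
    | base => exact le_max_left _ _
    | succ k hk ih =>
      rw [R.run.merit_update (k + 1)]
      split_ifs with h2
      · exact (mul_le_mul_of_nonneg_left (hN (k + 1) (by omega))
          (by linarith [R.valid.ν_gt])).trans (le_max_right _ _)
      · exact ih
  refine IsBigO.of_bound (max (h.μ N) (p.ν * K)) (eventually_atTop.2 ⟨N, fun k hk => ?_⟩)
  rw [Real.norm_of_nonneg (R.mu_pos k).le]
  simpa using h1 k hk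

/-! ### Acceptance of the trial steps -/

theorem v_mem_range (R : ConvergentRun f c p h X xs ls) (k : ℕ) :
    h.v k ∈ Set.range (jacT c (h.x k)) := by
  obtain ⟨z, hz⟩ := (R.run.normal k).mem_range
  exact ⟨h.β k • z, by rw [map_smul, hz]; rfl⟩

theorem v_isBigO_d (R : ConvergentRun f c p h X xs ls) {l : Filter ℕ} (hl : l ≤ atTop) :
    h.v =O[l] h.d := by
  refine (R.isBigO_jac_apply (Eventually.of_forall R.v_mem_range)).trans ?_
  refine (R.jac_apply_isBigO hl h.d).congr_left fun k => R.jac_d k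

/-- A full normal step leaves a third order linearized infeasibility. -/
theorem linearization_isBigO (R : ConvergentRun f c p h X xs ls) {l : Filter ℕ}
    (hβ : ∀ᶠ k in l, h.β k = 1) :
    (fun k => c (h.x k) + jac c (h.x k) (h.d k)) =O[l] fun k => ‖h.v k‖ ^ 3 := by
  refine IsBigO.of_bound p.rv (hβ.mono fun k hk => ?_)
  rw [R.jac_d, History.v, hk, one_smul, add_comm, norm_pow, norm_norm]
  exact R.residual_le_cube k

/-- The reduction of the merit function by the uncorrected trial step falls short of the predicted
one by at most a second order term. -/
theorem exists_merit_error_le (R : ConvergentRun f c p h X xs ls) :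
    ∃ C > 0, ∀ᶠ k in atTop, h.deltaQ f c k
      - (merit f c (h.x k) (h.μ k) - merit f c (h.x k + h.d k) (h.μ k))
      ≤ C * (1 + h.μ k) * ‖h.d k‖ ^ 2 := by
  obtain ⟨Lf, hLf, rf, hrf, hTf⟩ := exists_norm_taylor_one_le R.f_smooth
  obtain ⟨Lc, hLc, rc, hrc, hTc⟩ := exists_norm_taylor_one_le R.c_smooth
  obtain ⟨κH, hκH, hH⟩ := R.f3
  have hxd : Tendsto (fun k => h.x k + h.d k) atTop (𝓝 xs) := by
    simpa using R.lim.add R.tendsto_d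
  refine ⟨Lf + κH + m * Lc, by positivity, ?_⟩
  filter_upwards [R.lim (ball_mem_nhds xs hrf), R.lim (ball_mem_nhds xs hrc),
    hxd (ball_mem_nhds xs hrf), hxd (ball_mem_nhds xs hrc)] with k h1 h2 h3 h4
  have e1 := hTf _ h1 _ h1 _ h3
  have e2 := hTc _ h2 _ h2 _ h4
  simp only [sub_self, norm_zero, zero_add, add_sub_cancel_left] at e1 e2
  have e3 := (le_abs_self _).trans e1
  rw [← inner_gradient_left] at e3
  have e4 : l1 (c (h.x k + h.d k)) ≤ l1 (c (h.x k) + jac c (h.x k) (h.d k))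
      + m * (Lc * ‖h.d k‖ * ‖h.d k‖) := by
    calc l1 (c (h.x k + h.d k)) = l1 ((c (h.x k) + jac c (h.x k) (h.d k))
        + (c (h.x k + h.d k) - c (h.x k) - jac c (h.x k) (h.d k))) := by
          rw [sub_sub, add_sub_cancel]
      _ ≤ _ := l1_add_le _ _
      _ ≤ _ := add_le_add_right ((l1_le_mul_norm _).trans
        (mul_le_mul_of_nonneg_left e2 (Nat.cast_nonneg m))) _
  have e5 : -(κH * ‖h.d k‖ ^ 2) ≤ ⟪h.d k, h.H f c k (h.d k)⟫_ℝ := by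
    have := (abs_le.1 (abs_real_inner_le_norm (h.d k) (h.H f c k (h.d k)))).1
    have h6 : ‖h.H f c k (h.d k)‖ ≤ κH * ‖h.d k‖ := ((h.H f c k).le_opNorm _).trans
            (mul_le_mul_of_nonneg_right (hH k) (norm_nonneg _))
    nlinarith [mul_le_mul_of_nonneg_left h6 (norm_nonneg (h.d k))]
  have hμ := R.mu_pos k
  have hσ := R.sigma_pos k
  have e6 := mul_le_mul_of_nonneg_left e4 hμ.le
  have e7 : 0 ≤ h.σ k / 3 * ‖h.d k‖ ^ 3 := by positivity
  have e8 : 0 ≤ h.μ k * (Lf + κH) * ‖h.d k‖ ^ 2 := by positivity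
  have e9 : 0 ≤ (m * Lc) * ‖h.d k‖ ^ 2 := by positivity
  have e10 : 0 ≤ κH * ‖h.d k‖ ^ 2 := by positivity
  simp only [History.deltaQ, History.q, merit, map_zero, inner_zero_right, norm_zero, add_zero]
  nlinarith

/-- Away from almost feasible iterations the normal step is of order `1 / √σ_k`, hence it dominates
the tangential step, and the predicted reduction is of first order in the length of the step. -/
theorem eventually_rho_ge (R : ConvergentRun f c p h X xs ls) :
    ∀ᶠ k in atTop, ¬ h.inK p k → p.η₁ ≤ h.ρ f c k := by
  obtain ⟨κ, hκ, hQ⟩ := R.exists_deltaQ_coercive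
  obtain ⟨C, hC, hE⟩ := R.exists_merit_error_le
  obtain ⟨κ', hκ', hT⟩ := R.exists_tangential_bounds
  have hζ := R.valid.ζ_mem.1
  have hη : 0 < 1 - p.η₁ := by linarith [R.valid.η₁_lt, R.valid.η₂_lt]
  have hv : Tendsto h.v atTop (𝓝 0) := R.v_isBigO.trans_tendsto R.tendsto_sub
  have hg : Tendsto (h.gTilde f c) atTop (𝓝 0) := R.gTilde_isBigO.trans_tendsto R.tendsto_sub
  have hg1 := hg.norm.eventually_lt_const (u := 1) (by simp)
  -- `‖d_k‖² ≤ a ‖v_k‖²` off the almost feasible iterations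
  set a := 4 / p.ζ ^ 2 + 2 with ha
  have ha0 : 0 < a := by positivity
  have hv1 := hv.norm.eventually_lt_const (u := (1 - p.η₁) * κ / (C * a))
    (by rw [norm_zero]; positivity)
  filter_upwards [hQ, hE, hT, hg1, hv1] with k hQk hEk hTk hgk hvk hK
  have hσ := R.sigma_pos k
  have hs := Real.sqrt_pos.2 hσ
  have hμ := R.mu_pos k
  have hvc : p.ζ < ‖h.vc k‖ * √(h.σ k) := by
    rw [History.inK, not_le, div_lt_iff₀ hs] at hK
    exact hK
  have hvc0 : 0 < ‖h.vc k‖ := by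
    by_contra hneg
    nlinarith
  have hcne : c (h.x k) ≠ 0 := fun h0 => by
    rw [((R.run.normal k).feasible h0).1, norm_zero] at hvc0
    exact lt_irrefl _ hvc0
  have hvζ : p.ζ ≤ ‖h.v k‖ * √(h.σ k) := by
    have hβ := ((R.run.normal k).infeasible hcne).1
    rw [R.norm_v, mul_assoc]
    rcases min_le_iff.1 hβ with h1 | h1
    · nlinarith
    · rw [div_le_iff₀ (by positivity)] at h1
      linarith [R.valid.ζ_mem.2]
  have hvζ2 : p.ζ ^ 2 ≤ ‖h.v k‖ ^ 2 * h.σ k := by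
    have := pow_le_pow_left₀ hζ.le hvζ 2
    rwa [mul_pow, Real.sq_sqrt hσ.le] at this
  have hv0 : 0 < ‖h.v k‖ := by
    by_contra hneg
    nlinarith
  have hu : ‖h.u k‖ ^ 2 ≤ 2 / p.ζ ^ 2 * ‖h.v k‖ ^ 2 := by
    have h1 : h.σ k * ‖h.u k‖ ^ 2 ≤ 2 := by linarith [hTk.2.1]
    rw [div_mul_eq_mul_div, le_div_iff₀ (by positivity)]
    calc ‖h.u k‖ ^ 2 * p.ζ ^ 2 ≤ ‖h.u k‖ ^ 2 * (‖h.v k‖ ^ 2 * h.σ k) := by gcongr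
      _ = (h.σ k * ‖h.u k‖ ^ 2) * ‖h.v k‖ ^ 2 := by ring
      _ ≤ _ := by gcongr
  have hd : ‖h.d k‖ ^ 2 ≤ a * ‖h.v k‖ ^ 2 := by
    have h1 : ‖h.d k‖ ^ 2 ≤ (‖h.v k‖ + ‖h.u k‖) ^ 2 := by
      gcongr; exact norm_add_le _ _
    have h2 : a * ‖h.v k‖ ^ 2 = 2 * (2 / p.ζ ^ 2 * ‖h.v k‖ ^ 2) + 2 * ‖h.v k‖ ^ 2 := by
      rw [ha]; ring
    nlinarith [sq_nonneg (‖h.v k‖ - ‖h.u k‖)]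
  have hq1 : κ * ((1 + h.μ k) * ‖h.v k‖) ≤ h.deltaQ f c k := by
    refine le_trans ?_ hQk
    gcongr
    nlinarith [sq_nonneg ‖h.u k‖]
  refine le_div_of_error_le (lt_of_lt_of_le (by positivity) hq1) (hEk.trans ?_)
  rw [lt_div_iff₀ (by positivity)] at hvk
  calc C * (1 + h.μ k) * ‖h.d k‖ ^ 2 ≤ C * (1 + h.μ k) * (a * ‖h.v k‖ ^ 2) := by gcongr
    _ = (‖h.v k‖ * (C * a)) * ((1 + h.μ k) * ‖h.v k‖) := by ring
    _ ≤ ((1 - p.η₁) * κ) * ((1 + h.μ k) * ‖h.v k‖) := by gcongr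
    _ = (1 - p.η₁) * (κ * ((1 + h.μ k) * ‖h.v k‖)) := by ring
    _ ≤ _ := by gcongr

/-- The filter of the iterations at which a correction is computed. -/
def correctedFilter (f : E n → ℝ) (c : E n → E m) (p : Params) (h : History n m) : Filter ℕ :=
  atTop ⊓ 𝓟 {k | h.Corrected f c p k}

theorem correctedFilter_le : correctedFilter f c p h ≤ atTop := inf_le_left

theorem eventually_corrected : ∀ᶠ k in correctedFilter f c p h, h.Corrected f c p k :=
  mem_inf_of_right (mem_principal_self _)

theorem eventually_corrected_beta (R : ConvergentRun f c p h X xs ls) :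
    ∀ᶠ k in correctedFilter f c p h, h.β k = 1 := by
  filter_upwards [eventually_corrected] with k hk
  refine R.beta_eq_one ?_
  have h1 := hk.2
  rw [History.inK, le_div_iff₀ (Real.sqrt_pos.2 (R.sigma_pos k))] at h1
  exact h1.trans R.valid.ζ_mem.2.le

theorem linearization_corrected_isBigO (R : ConvergentRun f c p h X xs ls) :
    (fun k => c (h.x k) + jac c (h.x k) (h.d k)) =O[correctedFilter f c p h]
      fun k => ‖h.d k‖ ^ 3 :=
  (R.linearization_isBigO R.eventually_corrected_beta).trans
    ((R.v_isBigO_d correctedFilter_le).norm_norm.pow 3)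

theorem cube_isLittleO_sq (R : ConvergentRun f c p h X xs ls) {l : Filter ℕ} (hl : l ≤ atTop) :
    (fun k => ‖h.d k‖ ^ 3) =o[l] fun k => ‖h.d k‖ ^ 2 := by
  have h1 : Tendsto (fun k => ‖h.d k‖) l (𝓝 0) := by simpa using (R.tendsto_d.mono_left hl).norm
  exact (isLittleO_pow_pow (show 2 < 3 by norm_num)).comp_tendsto h1

theorem sq_isBigO_norm_d (R : ConvergentRun f c p h X xs ls) {l : Filter ℕ} (hl : l ≤ atTop) :
    (fun k => ‖h.d k‖ ^ 2) =O[l] fun k => ‖h.d k‖ := by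
  have h1 : Tendsto (fun k => ‖h.d k‖) l (𝓝 0) := by simpa using (R.tendsto_d.mono_left hl).norm
  exact ((isLittleO_pow_id (show 1 < 2 by norm_num)).comp_tendsto h1).isBigO

/-- The correction is of second order, because a full trial step leaves a second order
infeasibility. -/
theorem w_isBigO (R : ConvergentRun f c p h X xs ls) :
    h.w =O[correctedFilter f c p h] fun k => ‖h.d k‖ ^ 2 := by
  have hl := correctedFilter_le (f := f) (c := c) (p := p) (h := h)
  obtain ⟨L, hL, r, hr, hT⟩ := exists_norm_taylor_one_le R.c_smooth
  have hxd : Tendsto (fun k => h.x k + h.d k) atTop (𝓝 xs) := by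
    simpa using R.lim.add R.tendsto_d
  have h1 : (fun k => c (h.x k + h.d k) - c (h.x k) - jac c (h.x k) (h.d k))
      =O[correctedFilter f c p h] fun k => ‖h.d k‖ ^ 2 := by
    refine IsBigO.mono (IsBigO.of_bound L ?_) hl
    filter_upwards [R.lim (ball_mem_nhds xs hr), hxd (ball_mem_nhds xs hr)] with k h1 h2
    have := hT _ h1 _ h1 _ h2
    simp only [sub_self, norm_zero, zero_add, add_sub_cancel_left] at this
    rw [norm_pow, norm_norm]
    exact this.trans_eq (by ring)
  have h3 := (R.cube_isLittleO_sq hl).isBigO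
  have h4 : (fun k => jac c (h.x k) (h.w k) + c (h.x k + h.d k))
      =O[correctedFilter f c p h] fun k => ‖h.d k‖ ^ 3 := by
    refine IsBigO.of_bound p.rw (eventually_corrected.mono fun k hk => ?_)
    rw [norm_pow, norm_norm]
    exact (R.run.correction k hk).2
  refine (R.isBigO_jac_apply (eventually_corrected.mono fun k hk =>
    (R.run.correction k hk).1)).trans ?_
  refine (((h4.trans h3).sub h1).sub (R.linearization_corrected_isBigO.trans h3)).congr_left
    fun k => ?_
  abel

/-- After the correction the infeasibility is of third order. -/
theorem c_corrected_isBigO (R : ConvergentRun f c p h X xs ls) :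
    (fun k => c (h.x k + (h.d k + h.w k))) =O[correctedFilter f c p h]
      fun k => ‖h.d k‖ ^ 3 := by
  have hl := correctedFilter_le (f := f) (c := c) (p := p) (h := h)
  obtain ⟨L, hL, r, hr, hT⟩ := exists_norm_taylor_one_le R.c_smooth
  have hw := R.w_isBigO
  have hwd : h.w =O[correctedFilter f c p h] fun k => ‖h.d k‖ :=
    hw.trans (R.sq_isBigO_norm_d hl)
  have hw0 : Tendsto h.w (correctedFilter f c p h) (𝓝 0) :=
    hwd.trans_tendsto (by simpa using (R.tendsto_d.mono_left hl).norm)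
  have hx := R.lim.mono_left hl
  have hxd : Tendsto (fun k => h.x k + h.d k) (correctedFilter f c p h) (𝓝 xs) := by
    simpa using hx.add (R.tendsto_d.mono_left hl)
  have hxdw : Tendsto (fun k => h.x k + h.d k + h.w k) (correctedFilter f c p h) (𝓝 xs) := by
    simpa using hxd.add hw0
  have h1 : (fun k => c (h.x k + h.d k + h.w k) - c (h.x k + h.d k) - jac c (h.x k) (h.w k))
      =O[correctedFilter f c p h] fun k => (‖h.d k‖ + ‖h.w k‖) * ‖h.w k‖ := by
    refine IsBigO.of_bound L ?_
    filter_upwards [hx (ball_mem_nhds xs hr), hxd (ball_mem_nhds xs hr),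
      hxdw (ball_mem_nhds xs hr)] with k h1 h2 h3
    have := hT _ h1 _ h2 _ h3
    simp only [add_sub_cancel_left] at this
    rw [Real.norm_of_nonneg (by positivity), ← mul_assoc]
    exact this
  have h2 : (fun k => (‖h.d k‖ + ‖h.w k‖) * ‖h.w k‖) =O[correctedFilter f c p h]
      fun k => ‖h.d k‖ ^ 3 := by
    refine ((((isBigO_refl (fun k => ‖h.d k‖) _).add hwd.norm_left).mul hw.norm_left)).congr_right
      fun k => ?_
    ring
  have h4 : (fun k => jac c (h.x k) (h.w k) + c (h.x k + h.d k))
      =O[correctedFilter f c p h] fun k => ‖h.d k‖ ^ 3 := by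
    refine IsBigO.of_bound p.rw (eventually_corrected.mono fun k hk => ?_)
    rw [norm_pow, norm_norm]
    exact (R.run.correction k hk).2
  refine ((h1.trans h2).add h4).congr_left fun k => ?_
  rw [← add_assoc (h.x k), add_comm (jac c (h.x k) (h.w k))]
  abel

/-- At the corrected point the merit function agrees with the quadratic part of its model up to
`o(‖d_k‖²)`: as the infeasibility is negligible, `f` may be replaced by the Lagrangian, whose
Hessian is the one of the model. The remaining terms of the model are nonnegative. -/
theorem merit_corrected_isLittleO (R : ConvergentRun f c p h X xs ls) :
    (fun k => merit f c (h.x k + (h.d k + h.w k)) (h.μ k) - f (h.x k)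
        - ⟪gradient f (h.x k), h.d k⟫_ℝ - 1 / 2 * ⟪h.d k, h.H f c k (h.d k)⟫_ℝ)
      =o[correctedFilter f c p h] fun k => ‖h.d k‖ ^ 2 := by
  have hl := correctedFilter_le (f := f) (c := c) (p := p) (h := h)
  have hw := R.w_isBigO
  have hd := (isBigO_refl (fun k => ‖h.d k‖) (correctedFilter f c p h)).of_norm_left
    (f' := h.d)
  have hwd : h.w =O[correctedFilter f c p h] fun k => ‖h.d k‖ :=
    hw.trans (R.sq_isBigO_norm_d hl)
  have hs : (fun k => h.d k + h.w k) =O[correctedFilter f c p h] fun k => ‖h.d k‖ := hd.add hwd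
  have hs0 : Tendsto (fun k => h.d k + h.w k) (correctedFilter f c p h) (𝓝 0) :=
    hs.trans_tendsto (by simpa using (R.tendsto_d.mono_left hl).norm)
  have hlam : h.lam =O[correctedFilter f c p h] fun _ => (1 : ℝ) :=
    (R.tendsto_lam.isBigO_one ℝ).mono hl
  have h3 := R.cube_isLittleO_sq hl
  have t1 := (lagr_taylor_isLittleO R.f_smooth R.c_smooth (R.lim.mono_left hl) hs0
    hlam).trans_isBigO (hs.norm_left.pow 2)
  have t2 : (fun k => ⟪h.lam k, c (h.x k + (h.d k + h.w k))⟫_ℝ) =o[correctedFilter f c p h]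
      fun k => ‖h.d k‖ ^ 2 := by
    refine IsBigO.trans_isLittleO ?_ h3
    simpa using isBigO_inner hlam R.c_corrected_isBigO
  have t3 : (fun k => ⟪h.lam k, c (h.x k) + jac c (h.x k) (h.d k)⟫_ℝ)
      =o[correctedFilter f c p h] fun k => ‖h.d k‖ ^ 2 := by
    refine IsBigO.trans_isLittleO ?_ h3
    simpa using isBigO_inner hlam R.linearization_corrected_isBigO
  have t4 : (fun k => ⟪gradient f (h.x k) + jacT c (h.x k) (h.lam k), h.w k⟫_ℝ)
      =o[correctedFilter f c p h] fun k => ‖h.d k‖ ^ 2 := by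
    have h4 : (fun k => gradient f (h.x k) + jacT c (h.x k) (h.lam k))
        =o[correctedFilter f c p h] fun _ => (1 : ℝ) :=
      (isLittleO_one_iff ℝ).2 ((R.gradLagr_lam_isBigO.trans_tendsto R.tendsto_sub).mono_left hl)
    have h5 := h4.norm_left.mul_isBigO hw.norm_left
    simp only [one_mul] at h5
    exact (IsBigO.of_norm_le fun k => norm_inner_le_norm _ _).trans_isLittleO h5
  have t5 : (fun k => ⟪h.w k, h.H f c k (h.d k + h.w k)⟫_ℝ)
      =o[correctedFilter f c p h] fun k => ‖h.d k‖ ^ 2 := by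
    refine IsBigO.trans_isLittleO ?_ h3
    exact (isBigO_inner hw ((R.H_apply_isBigO _).trans hs)).congr_right fun k => by ring
  have t6 : (fun k => ⟪h.d k, h.H f c k (h.w k)⟫_ℝ)
      =o[correctedFilter f c p h] fun k => ‖h.d k‖ ^ 2 := by
    refine IsBigO.trans_isLittleO ?_ h3
    exact (isBigO_inner hd ((R.H_apply_isBigO _).trans hw)).congr_right fun k => by ring
  have t7 : (fun k => h.μ k * l1 (c (h.x k + (h.d k + h.w k))))
      =o[correctedFilter f c p h] fun k => ‖h.d k‖ ^ 2 := by
    refine IsBigO.trans_isLittleO ?_ h3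
    have h4 : (fun k => l1 (c (h.x k + (h.d k + h.w k)))) =O[correctedFilter f c p h]
        fun k => ‖h.d k‖ ^ 3 := by
      refine IsBigO.trans (IsBigO.of_bound m (Eventually.of_forall fun k => ?_))
        R.c_corrected_isBigO
      rw [Real.norm_of_nonneg (l1_nonneg _)]
      exact l1_le_mul_norm _
    simpa using (R.mu_isBigO_one.mono hl).mul h4
  refine ((((((t1.sub t2).add t3).add t4).add (t5.const_mul_left (1 / 2))).add
    (t6.const_mul_left (1 / 2))).add t7).congr_left fun k => ?_
  simp only [lagr, merit, History.H, map_add, inner_add_left, inner_add_right, jacT,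
    ContinuousLinearMap.adjoint_inner_left]
  ring

/-- The predicted reduction is at least a multiple of `‖d_k‖²`, which outweighs the error of the
corrected step. -/
theorem eventually_rhocorr_ge (R : ConvergentRun f c p h X xs ls) :
    ∀ᶠ k in atTop, h.Corrected f c p k → 0 < h.deltaQ f c k → p.η₁ ≤ h.ρcorr f c k := by
  have hl := correctedFilter_le (f := f) (c := c) (p := p) (h := h)
  obtain ⟨κ, hκ, hQ⟩ := R.exists_deltaQ_coercive
  have hη : 0 < 1 - p.η₁ := by linarith [R.valid.η₁_lt, R.valid.η₂_lt]
  have hv : Tendsto h.v atTop (𝓝 0) := R.v_isBigO.trans_tendsto R.tendsto_sub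
  have hv1 := hv.norm.eventually_lt_const (u := 1) (by simp)
  have hE := R.merit_corrected_isLittleO.bound
    (show 0 < (1 - p.η₁) * (κ / 2) by positivity)
  have key : ∀ᶠ k in correctedFilter f c p h, 0 < h.deltaQ f c k → p.η₁ ≤ h.ρcorr f c k := by
    filter_upwards [hl hQ, hl hv1, hE] with k hQk hvk hEk hpos
    refine le_div_of_error_le hpos ?_
    have hμ := R.mu_pos k
    have hσ := R.sigma_pos k
    have h1 := (le_abs_self _).trans hEk
    rw [norm_pow, norm_norm] at h1
    have h2 : κ / 2 * ‖h.d k‖ ^ 2 ≤ h.deltaQ f c k := by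
      have h3 : ‖h.d k‖ ^ 2 ≤ (‖h.v k‖ + ‖h.u k‖) ^ 2 := by
        gcongr; exact norm_add_le _ _
      have h4 : ‖h.d k‖ ^ 2 ≤ 2 * (‖h.u k‖ ^ 2 + (1 + h.μ k) * ‖h.v k‖) := by
        nlinarith [sq_nonneg (‖h.v k‖ - ‖h.u k‖), norm_nonneg (h.v k),
          mul_nonneg hμ.le (norm_nonneg (h.v k))]
      nlinarith
    have h3 := mul_le_mul_of_nonneg_left h2 hη.le
    have h4 : 0 ≤ h.σ k / 3 * ‖h.d k‖ ^ 3 := by positivity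
    have h5 : 0 ≤ h.μ k * l1 (c (h.x k) + jac c (h.x k) (h.d k)) :=
      mul_nonneg hμ.le (l1_nonneg _)
    have h6 : h.deltaQ f c k - (merit f c (h.x k) (h.μ k)
        - merit f c (h.x k + h.d k + h.w k) (h.μ k))
        = (merit f c (h.x k + (h.d k + h.w k)) (h.μ k) - f (h.x k)
        - ⟪gradient f (h.x k), h.d k⟫_ℝ - 1 / 2 * ⟪h.d k, h.H f c k (h.d k)⟫_ℝ)
        - h.σ k / 3 * ‖h.d k‖ ^ 3 - h.μ k * l1 (c (h.x k) + jac c (h.x k) (h.d k)) := by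
      rw [add_assoc (h.x k)]
      simp only [History.deltaQ, History.q, map_zero, inner_zero_right, norm_zero, add_zero]
      rw [merit]
      ring
    rw [h6]
    linarith
  exact eventually_inf_principal.1 key

/-! ### The Newton estimate -/

/-- The expansion of the gradient around `x_k`, evaluated at the limit point. The limit need not
belong to `X`, so the bound is first proved at the later iterates. -/
theorem gradient_taylor_isBigO (R : ConvergentRun f c p h X xs ls) {F : E n → ℝ}
    (hF : ContDiffAt ℝ 2 F xs) (hFX : ∀ x ∈ X, ContDiffAt ℝ 2 F x) (hL : LipOn (hess F) X) :
    (fun k => gradient F xs - gradient F (h.x k) - hess F (h.x k) (xs - h.x k))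
      =O[atTop] fun k => ‖h.x k - xs‖ ^ 2 := by
  obtain ⟨L, hL⟩ := hL
  refine IsBigO.of_bound L (Eventually.of_forall fun k => ?_)
  have h1 : ∀ j, ‖gradient F (h.x j) - gradient F (h.x k) - hess F (h.x k) (h.x j - h.x k)‖
      ≤ L * (‖h.x k - h.x k‖ + ‖h.x j - h.x k‖) * ‖h.x j - h.x k‖ := fun j =>
    norm_taylor_one_le R.convex (fun y hy => differentiableAt_gradient (hFX y hy)) hL (R.mem k)
      (R.mem k) (R.mem j)
  have h2 : Tendsto (fun j => h.x j - h.x k) atTop (𝓝 (xs - h.x k)) := R.lim.sub_const _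
  have h3 : Tendsto (fun j => gradient F (h.x j)) atTop (𝓝 (gradient F xs)) :=
    (contDiffAt_gradient hF).continuousAt.tendsto.comp R.lim
  have h4 := le_of_tendsto_of_tendsto'
    ((h3.sub_const (gradient F (h.x k))).sub (((hess F (h.x k)).continuous.tendsto _).comp h2)).norm
    (((h2.norm.const_add ‖h.x k - h.x k‖).const_mul (L : ℝ)).mul h2.norm) h1
  rw [sub_self, norm_zero, zero_add, norm_sub_rev xs] at h4
  rw [norm_pow, norm_norm]
  exact h4.trans_eq (by ring)

theorem gradLagr_taylor_isBigO (R : ConvergentRun f c p h X xs ls) :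
    (fun k => gradient f (h.x k) + jacT c (h.x k) ls - hessL f c (h.x k) ls (h.x k - xs))
      =O[atTop] fun k => ‖h.x k - xs‖ ^ 2 := by
  have h1 := R.gradient_taylor_isBigO R.f_smooth
    (fun x hx => R.f1.f_smooth.contDiffAt (R.isOpen.mem_nhds hx)) R.f5.hf_lip
  have h2 : ∀ i, _ := fun i => R.gradient_taylor_isBigO (contDiffAt_comp R.c_smooth i)
    (fun x hx => contDiffAt_comp (R.f1.c_smooth.contDiffAt (R.isOpen.mem_nhds hx)) i)
    (R.f5.hc_lip i)
  have h3 : gradient f xs + ∑ i, ls i • gradient (comp c i) xs = 0 := by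
    rw [← gradient_lagr_eq_sum (R.f_smooth.differentiableAt (by norm_num))
      (R.c_smooth.differentiableAt (by norm_num)), R.sosc.stationary]
  refine (h1.add (IsBigO.fun_sum fun i (_ : i ∈ Finset.univ) =>
    (h2 i).const_smul_left (ls i))).neg_left.congr_left fun k => ?_
  rw [jacT_eq_sum ((R.contDiffAt_c k).differentiableAt (by norm_num))]
  simp only [hessL, smul_sub, Finset.sum_sub_distrib, Pi.smul_apply, add_apply, sum_apply,
    smul_apply, map_sub]
  rw [← sub_eq_zero]
  refine Eq.trans ?_ (congrArg Neg.neg h3 |>.trans neg_zero)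
  abel

/-- Replacing the multiplier estimate by the exact multiplier in the Hessian costs only a second
order term in the Newton equation. -/
theorem H_sub_hessL_isBigO (R : ConvergentRun f c p h X xs ls) :
    (fun k => (h.H f c k - hessL f c (h.x k) ls) (h.x k - xs))
      =O[atTop] fun k => ‖h.x k - xs‖ ^ 2 := by
  have h1 : ∀ i, (fun k => (h.lam k i - ls i) • hess (comp c i) (h.x k) (h.x k - xs))
      =O[atTop] fun k => ‖h.x k - xs‖ ^ 2 := by
    intro i
    have h2 : (fun k => h.lam k i - ls i) =O[atTop] fun k => ‖h.x k - xs‖ :=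
      ((IsBigO.of_norm_le fun k => PiLp.norm_apply_le (h.lam k - ls) i).trans
        R.lam_sub_isBigO.norm_left).norm_right
    have h3 : (fun k => hess (comp c i) (h.x k)) =O[atTop] fun _ => (1 : ℝ) :=
      ((continuousAt_hess (contDiffAt_comp R.c_smooth i)).tendsto.comp R.lim).isBigO_one ℝ
    exact (h2.smul (isBigO_clm_apply h3 fun k => h.x k - xs).norm_right).congr_right
      fun k => by simp only [smul_eq_mul]; ring
  refine (IsBigO.fun_sum fun i (_ : i ∈ Finset.univ) => h1 i).congr_left fun k => ?_
  simp only [History.H, hessL, sub_apply, add_apply, sum_apply, smul_apply, sub_smul,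
    Finset.sum_sub_distrib]
  abel

/-- The full step `x_k + d_k` is an inexact Newton step on the optimality system, whose error is
governed by the inexactness allowed in the normal and tangential subproblems. -/
theorem newton_isBigO (R : ConvergentRun f c p h X xs ls) :
    (fun k => h.x k - xs + h.d k) =O[atTop] fun k => ‖h.x k - xs‖ ^ 2
      + h.σ k * ‖h.u k‖ ^ 2 + ‖c (h.x k) + jac c (h.x k) (h.d k)‖ := by
  set B := fun k => ‖h.x k - xs‖ ^ 2 + h.σ k * ‖h.u k‖ ^ 2
    + ‖c (h.x k) + jac c (h.x k) (h.d k)‖ with hB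
  have hσ := fun k => (R.sigma_pos k).le
  have b1 : (fun k => ‖h.x k - xs‖ ^ 2) =O[atTop] B := IsBigO.of_norm_le fun k => by
    rw [Real.norm_of_nonneg (by positivity)]
    have := mul_nonneg (hσ k) (sq_nonneg ‖h.u k‖)
    have := norm_nonneg (c (h.x k) + jac c (h.x k) (h.d k))
    simp only [hB]; linarith
  have b2 : (fun k => h.σ k * ‖h.u k‖ ^ 2) =O[atTop] B := IsBigO.of_norm_le fun k => by
    rw [Real.norm_of_nonneg (mul_nonneg (hσ k) (sq_nonneg ‖h.u k‖))]
    have := sq_nonneg ‖h.x k - xs‖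
    have := norm_nonneg (c (h.x k) + jac c (h.x k) (h.d k))
    simp only [hB]; linarith
  have b3 : (fun k => c (h.x k) + jac c (h.x k) (h.d k)) =O[atTop] B :=
    IsBigO.of_norm_le fun k => by
      have := sq_nonneg ‖h.x k - xs‖
      have := mul_nonneg (hσ k) (sq_nonneg ‖h.u k‖)
      simp only [hB]; linarith
  let y := fun k => h.x k - xs + h.d k
  let t := fun k => y k - proj c (h.x k) (y k)
  -- the component of the error in the range of `A_kᵀ` is controlled by the constraints
  have hc : (fun k => c xs - c (h.x k) - jac c (h.x k) (xs - h.x k))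
      =O[atTop] fun k => ‖h.x k - xs‖ ^ 2 := by
    obtain ⟨L, hL, r, hr, hT⟩ := exists_norm_taylor_one_le R.c_smooth
    refine IsBigO.of_bound L ?_
    filter_upwards [R.lim (ball_mem_nhds xs hr)] with k h1
    have := hT _ h1 _ h1 _ (mem_ball_self hr)
    rw [sub_self, norm_zero, zero_add, norm_sub_rev xs] at this
    rw [norm_pow, norm_norm]
    exact this.trans_eq (by ring)
  have hAt : (fun k => jac c (h.x k) (t k)) =O[atTop] B := by
    refine ((hc.trans b1).add b3).congr_left fun k => ?_
    simp only [t, y, map_sub, map_add, jac_proj, R.sosc.feasible]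
    abel
  have ht : t =O[atTop] B := (R.isBigO_jac_apply (Eventually.of_forall fun k =>
    sub_proj_mem_range c (h.x k) (y k))).trans hAt
  -- the component in the null space of `A_k` is controlled by the projected Newton equation
  have hN : (fun k => proj c (h.x k) (gradient f (h.x k) + h.H f c k (h.d k))) =O[atTop] B := by
    refine IsBigO.trans (IsBigO.of_bound (p.δ + 1) (Eventually.of_forall fun k => ?_)) b2
    have h1 := (R.run.tangential k).gradient_le
    have h2 := eq_sub_of_add_eq (R.gradient_mU_u k).symm
    rw [h2, Real.norm_of_nonneg (mul_nonneg (hσ k) (sq_nonneg ‖h.u k‖))]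
    refine (norm_sub_le _ _).trans ?_
    rw [norm_smul, Real.norm_of_nonneg (mul_nonneg (hσ k) (norm_nonneg _))]
    linarith
  have hPH : (fun k => proj c (h.x k) (h.H f c k (y k))) =O[atTop] B := by
    have h1 : (fun k => proj c (h.x k) ((gradient f (h.x k) + jacT c (h.x k) ls
        - hessL f c (h.x k) ls (h.x k - xs))
        - (h.H f c k - hessL f c (h.x k) ls) (h.x k - xs))) =O[atTop] B :=
      (IsBigO.of_norm_le fun k => norm_proj_le _ _ _).trans
        ((R.gradLagr_taylor_isBigO.sub R.H_sub_hessL_isBigO).trans b1).norm_left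
    refine (hN.sub h1).congr_left fun k => ?_
    simp only [y, sub_apply, map_add, map_sub, proj_jacT]
    abel
  have hPHP : (fun k => proj c (h.x k) (h.H f c k (proj c (h.x k) (y k)))) =O[atTop] B := by
    have h1 : (fun k => proj c (h.x k) (h.H f c k (t k))) =O[atTop] B :=
      (IsBigO.of_norm_le fun k => norm_proj_le _ _ _).trans
        ((R.H_apply_isBigO t).trans ht).norm_left
    refine (hPH.sub h1).congr_left fun k => ?_
    simp only [t, map_sub]
    abel
  obtain ⟨κ, hκ, hcoer⟩ := R.exists_coercive
  have hP : (fun k => proj c (h.x k) (y k)) =O[atTop] B := by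
    refine IsBigO.trans (IsBigO.of_bound κ⁻¹ (hcoer.mono fun k hk => ?_)) hPHP
    rw [inv_mul_eq_div, le_div_iff₀ hκ, mul_comm]
    set z := proj c (h.x k) (y k) with hz
    have hAz : jac c (h.x k) z = 0 := jac_proj c (h.x k) (y k)
    have h1 := hk z hAz
    have h2 : ⟪z, h.H f c k z⟫_ℝ ≤ ‖z‖ * ‖proj c (h.x k) (h.H f c k z)‖ := by
      have h3 : ⟪z, h.H f c k z⟫_ℝ = ⟪z, proj c (h.x k) (h.H f c k z)⟫_ℝ := by
        rw [← inner_proj, proj_eq_self hAz]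
      rw [h3]
      exact real_inner_le_norm _ _
    rcases (norm_nonneg z).eq_or_lt with h0 | h0
    · rw [← h0, mul_zero]; exact norm_nonneg _
    · refine le_of_mul_le_mul_right ?_ h0
      nlinarith
  refine (hP.add ht).congr_left fun k => ?_
  simp [t, y]

/-! ### Finite termination or quadratic convergence -/

/-- At the solution the computed step vanishes. -/
theorem eventually_stays (R : ConvergentRun f c p h X xs ls) :
    ∀ᶠ k in atTop, h.x k = xs → h.x (k + 1) = xs := by
  obtain ⟨C, hC⟩ := R.d_isBigO.bound
  filter_upwards [hC] with k hk hx
  have hd : h.d k = 0 := by simpa [hx] using hk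
  -- the ratios are `0 / 0`, so that the iteration is rejected
  have hq : h.deltaQ f c k = 0 := by rw [History.deltaQ, hd, sub_self]
  have hη := R.valid.η₁_pos
  rw [R.run.x_update k, if_neg (by rw [History.ρ, hq, div_zero]; exact hη.not_ge),
    if_neg (by rw [History.ρcorr, hq, div_zero]; exact fun h1 => hη.not_ge h1.2), hx]

/-- A vanishing predicted reduction forces `d_k = 0` and `c_k = 0`; the Newton estimate then reads
`‖x_k - x*‖ = O(‖x_k - x*‖²)`, which near `x*` is possible only for `x_k = x*`. -/
theorem eventually_deltaQ_pos (R : ConvergentRun f c p h X xs ls) :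
    ∀ᶠ k in atTop, h.x k ≠ xs → 0 < h.deltaQ f c k := by
  obtain ⟨κ, hκ, hQ⟩ := R.exists_deltaQ_coercive
  obtain ⟨C, hC0, hC⟩ := R.newton_isBigO.exists_pos
  have hsmall := R.tendsto_sub.norm.eventually_lt_const (u := C⁻¹) (by simpa using hC0)
  filter_upwards [hQ, hC.bound, hsmall] with k hQk hCk hk hne
  have hμ := R.mu_pos k
  have hnn : 0 ≤ (1 + h.μ k) * ‖h.v k‖ := by positivity
  by_contra hneg
  have h1 : ‖h.u k‖ ^ 2 + (1 + h.μ k) * ‖h.v k‖ ≤ 0 := by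
    by_contra h2
    nlinarith [mul_pos hκ (not_le.1 h2)]
  have hu : h.u k = 0 := by
    have : ‖h.u k‖ ^ 2 = 0 := le_antisymm (by linarith) (sq_nonneg _)
    simpa using this
  have hv : h.v k = 0 := by
    have h2 : (1 + h.μ k) * ‖h.v k‖ = 0 := le_antisymm (by linarith [sq_nonneg ‖h.u k‖]) hnn
    simpa [(by positivity : 1 + h.μ k ≠ 0)] using h2
  have hc : c (h.x k) = 0 := by
    by_contra h2
    have h3 := R.vc_ne_zero h2
    exact h3 ((smul_eq_zero.1 hv).resolve_left (R.beta_pos k).ne')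
  simp only [History.d, hu, hv, hc, add_zero, map_zero, norm_zero, ne_eq, OfNat.ofNat_ne_zero,
    not_false_eq_true, zero_pow, mul_zero, norm_pow, norm_norm] at hCk
  have h4 := norm_pos_iff.2 (sub_ne_zero.2 hne)
  have h5 := mul_lt_mul_of_pos_left hk hC0
  rw [mul_inv_cancel₀ hC0.ne'] at h5
  nlinarith

/-- Unless the solution has been reached, either no correction is needed or the corrected step is
accepted. -/
theorem eventually_successful (R : ConvergentRun f c p h X xs ls) :
    ∀ᶠ k in atTop, h.x k ≠ xs → h.Successful f c p k := by
  filter_upwards [R.eventually_deltaQ_pos, R.eventually_rhocorr_ge, R.eventually_rho_ge]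
    with k h1 h2 h3 hne
  unfold History.Successful History.ratio
  split_ifs with hcor
  · exact h2 hcor (h1 hne)
  · by_contra h4
    exact h4 (h3 fun hK => hcor ⟨not_le.1 h4, hK⟩)

theorem sigma_isBigO_one (R : ConvergentRun f c p h X xs ls)
    (hs : ∀ᶠ k in atTop, h.Successful f c p k) : h.σ =O[atTop] fun _ => (1 : ℝ) := by
  obtain ⟨N, hN⟩ := eventually_atTop.1 hs
  have h1 : ∀ k ≥ N, h.σ k ≤ h.σ N := by
    intro k hk
    induction k, hk using Nat.le_induction with
    | base => exact le_rfl
    | succ k hk ih =>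
      rcases le_or_gt (h.ratio f c p k) p.η₂ with h2 | h2
      · rw [R.run.sigma_successful k (hN k hk) h2]; exact ih
      · exact (R.run.sigma_very_successful k h2).2.trans ih
  refine IsBigO.of_bound (h.σ N) (eventually_atTop.2 ⟨N, fun k hk => ?_⟩)
  rw [Real.norm_of_nonneg (R.sigma_pos k).le]
  simpa using h1 k hk

/-- Once all iterations are successful, the regularization parameter is bounded, full normal steps
are taken, and every error in the Newton estimate is of second order. -/
theorem step_isBigO_of_successful (R : ConvergentRun f c p h X xs ls)
    (hs : ∀ᶠ k in atTop, h.Successful f c p k) :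
    (fun k => h.x (k + 1) - xs) =O[atTop] fun k => ‖h.x k - xs‖ ^ 2 := by
  obtain ⟨S, hS⟩ := (R.sigma_isBigO_one hs).bound
  have hvc : Tendsto (fun k => ‖h.vc k‖ * √S) atTop (𝓝 0) := by
    simpa using (R.vc_isBigO.trans_tendsto R.tendsto_sub).norm.mul_const √S
  have hβ : ∀ᶠ k in atTop, h.β k = 1 := by
    filter_upwards [hvc.eventually_lt_const R.valid.θ_mem.1, hS] with k h1 h2
    refine R.beta_eq_one (le_trans ?_ h1.le)
    gcongr
    simpa [abs_of_pos (R.sigma_pos k)] using h2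
  have hcube : (fun k => ‖h.x k - xs‖ ^ 3) =O[atTop] fun k => ‖h.x k - xs‖ ^ 2 := by
    have h1 : Tendsto (fun k => ‖h.x k - xs‖) atTop (𝓝 0) := by simpa using R.tendsto_sub.norm
    exact ((isLittleO_pow_pow (show 2 < 3 by norm_num)).comp_tendsto h1).isBigO
  have h1 : (fun k => c (h.x k) + jac c (h.x k) (h.d k)) =O[atTop]
      fun k => ‖h.x k - xs‖ ^ 2 :=
    ((R.linearization_isBigO hβ).trans (R.v_isBigO.norm_norm.pow 3)).trans hcube
  have h2 : (fun k => h.σ k * ‖h.u k‖ ^ 2) =O[atTop] fun k => ‖h.x k - xs‖ ^ 2 := by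
    simpa using (R.sigma_isBigO_one hs).mul (R.u_isBigO.norm_norm.pow 2)
  have h3 : (fun k => h.x k - xs + h.d k) =O[atTop] fun k => ‖h.x k - xs‖ ^ 2 :=
    R.newton_isBigO.trans (((isBigO_refl _ _).add h2).add h1.norm_left)
  have h4 : h.w =O[correctedFilter f c p h] fun k => ‖h.x k - xs‖ ^ 2 :=
    R.w_isBigO.trans ((R.d_isBigO.norm_norm.pow 2).mono correctedFilter_le)
  obtain ⟨C, hC0, hC⟩ := h3.exists_nonneg
  obtain ⟨D, hD0, hD⟩ := h4.exists_nonneg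
  refine IsBigO.of_bound (C + D) ?_
  filter_upwards [hC.bound, eventually_inf_principal.1 hD.bound, hs] with k hCk hDk hsk
  rw [R.run.x_update k]
  split_ifs with h5 h6
  · rw [add_sub_right_comm]
    refine hCk.trans ?_
    gcongr
    linarith
  · have h7 : h.x k + h.d k + h.w k - xs = (h.x k - xs + h.d k) + h.w k := by abel
    rw [h7, add_mul]
    exact (norm_add_le _ _).trans (add_le_add hCk (hDk ⟨not_le.1 h5, h6.1⟩))
  · exfalso
    unfold History.Successful History.ratio at hsk
    split_ifs at hsk with hcor
    · exact h6 ⟨hcor.2, hsk⟩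
    · exact h5 hsk

theorem qQuadratic (R : ConvergentRun f c p h X xs ls) : QQuadratic h.x xs := by
  refine ⟨R.lim, ?_⟩
  obtain ⟨N, hN⟩ := eventually_atTop.1 R.eventually_stays
  by_cases hfin : ∃ k ≥ N, h.x k = xs
  · obtain ⟨K, hK, hxK⟩ := hfin
    have h1 : ∀ k ≥ K, h.x k = xs := by
      intro k hk
      induction k, hk using Nat.le_induction with
      | base => exact hxK
      | succ k hk ih => exact hN k (hK.trans hk) ih
    refine ⟨1, one_pos, eventually_atTop.2 ⟨K, fun k hk => ?_⟩⟩
    rw [h1 (k + 1) (hk.trans k.le_succ), sub_self, norm_zero]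
    positivity
  · push Not at hfin
    have h1 : ∀ᶠ k in atTop, h.Successful f c p k := by
      filter_upwards [R.eventually_successful, eventually_ge_atTop N] with k h2 h3
      exact h2 (hfin k h3)
    obtain ⟨C, hC0, hC⟩ := (R.step_isBigO_of_successful h1).exists_pos
    refine ⟨C, hC0, hC.bound.mono fun k hk => ?_⟩
    simpa using hk

end ConvergentRun

end SCP

theorem mainTheorem7 {n m : ℕ} (f : SCP.E n → ℝ) (c : SCP.E n → SCP.E m)
    (p : SCP.Params) (hp : p.Valid)
    (h : SCP.History n m) (hrun : h.IsRun f c p)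
    (X : Set (SCP.E n)) (hXo : IsOpen X) (hXc : Convex ℝ X) (hX : ∀ k, h.x k ∈ X)
    (hF1 : SCP.F1 f c X) (hF2 : SCP.F2 c X) (hF3 : SCP.F3 f c h) (hF4 : SCP.F4 f c p h)
    (hF5 : SCP.F5 f c X)
    (xs : SCP.E n) (ls : SCP.E m)
    (hf : ContDiffAt ℝ 2 f xs) (hc : ContDiffAt ℝ 2 c xs)
    (hlim : Filter.Tendsto h.x Filter.atTop (nhds xs))
    (hsosc : SCP.SOSC f c xs ls) :
    SCP.QQuadratic h.x xs :=
  (SCP.ConvergentRun.mk hp hrun hXo hXc hX hF1 hF2 hF3 hF5 hf hc hlim hsosc).qQuadratic
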